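/- Let $\mu$ be a non-atomic Borel probability measure on $[0,1]$. The Krein–Feller operator $\frac{d}{d\mu}\frac{d}{dx}$ is defined on the functions $f\in C^1([0,1])$ for which there is $(f')^\mu\in L_2([0,1],\mu)$ with $f'(x)=f'(0)+\int_0^x (f')^\mu\,d\mu$ for all $x\in[0,1]$, and it maps $f$ to $(f')^\mu$. A real number $\lambda$ is a Neumann (respectively Dirichlet) eigenvalue if $\frac{d}{d\mu}\frac{d}{dx}f=-\lambda f$ in $L_2([0,1],\mu)$ for some $f\not\equiv 0$ in this domain with $f'(0)=f'(1)=0$ (respectively $f(0)=f(1)=0$). Then the Neumann eigenvalues form a strictly increasing infinite sequence $\lambda_{N,0}<\lambda_{N,1}<\lambda_{N,2}<\cdots$ and the Dirichlet eigenvalues a strictly increasing infinite sequence $\lambda_{D,1}<\lambda_{D,2}<\cdots$, and the following holds. For every $m\in\mathbb{N}_0$ there is a constant $c>0$ depending only on $\mu$ and $m$ such that, for every sequence $(\mu_n)_n$ of non-atomic Borel probability measures on $[0,1]$ whose distribution functions $F_n$ converge uniformly to the distribution function $F$ of $\mu$, there is $n_0$ with $$|\lambda_{N,m}-\lambda_{N,m,n}|\le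 c\,\|F-F_n\|_\infty\qquad\text{for all } n\ge n_0,$$ where $\lambda_{N,m,n}$ denotes the $m$-th Neumann eigenvalue for $\mu_n$. In the same way, for every $m\ge 1$ there is a constant $c>0$ depending only on $\mu$ and $m$ such that, for every such sequence $(\mu_n)_n$, there is $n_0$ with $$|\lambda_{D,m}-\lambda_{D,m,n}|\le c\,\|F-F_n\|_\infty\qquad\text{for all } n\ge n_0,$$ where $\lambda_{D,m,n}$ denotes the $m$-th Dirichlet eigenvalue for $\mu_n$. -/

import Mathlib

open MeasureTheory Set Filter ProbabilityTheory

namespace KreinFeller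

/-- `g` is a `μ`-derivative of `h` on `[0,1]`: `g ∈ L₂(μ)` and
`h x = h 0 + ∫₀ˣ g dμ` for every `x ∈ [0,1]`. -/
def IsMuDeriv (μ : Measure ℝ) (h g : ℝ → ℝ) : Prop :=
  MemLp g 2 μ ∧ ∀ x ∈ Icc (0 : ℝ) 1, h x = h 0 + ∫ y in (0 : ℝ)..x, g y ∂μ

/-- The graph of the Krein–Feller operator `d/dμ d/dx`: the function `f` is `C¹` on `[0,1]` and
its derivative (one-sided at the end points) has the `μ`-derivative `g`.
Values of `f` outside `[0,1]` are irrelevant. -/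
def Graph (μ : Measure ℝ) (f g : ℝ → ℝ) : Prop :=
  ContDiffOn ℝ 1 f (Icc 0 1) ∧ IsMuDeriv μ (derivWithin f (Icc 0 1)) g

/-- `f` is a solution, not identically zero on `[0,1]`, of `d/dμ d/dx f = -l f`
as an equation in `L₂(μ)`. -/
def IsEigenfunction (μ : Measure ℝ) (l : ℝ) (f : ℝ → ℝ) : Prop :=
  (∃ x ∈ Icc (0 : ℝ) 1, f x ≠ 0) ∧ ∃ g : ℝ → ℝ, Graph μ f g ∧ g =ᵐ[μ] fun x => -l * f x

/-- The set of Neumann eigenvalues (boundary conditions `f'(0) = f'(1) = 0`). -/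
def neumannSpectrum (μ : Measure ℝ) : Set ℝ :=
  {l | ∃ f : ℝ → ℝ, IsEigenfunction μ l f ∧
    derivWithin f (Icc 0 1) 0 = 0 ∧ derivWithin f (Icc 0 1) 1 = 0}

/-- The set of Dirichlet eigenvalues (boundary conditions `f(0) = f(1) = 0`). -/
def dirichletSpectrum (μ : Measure ℝ) : Set ℝ :=
  {l | ∃ f : ℝ → ℝ, IsEigenfunction μ l f ∧ f 0 = 0 ∧ f 1 = 0}

/-- The `k`-th element, counted from `k = 0` in increasing order, of a set `S` of real numbers:
the least element of `S` that has at least `k` elements of `S` strictly below it. -/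
noncomputable def nthLeast (S : Set ℝ) (k : ℕ) : ℝ :=
  sInf {s | s ∈ S ∧ (k : ℕ∞) ≤ (S ∩ Iio s).encard}

/-- The Neumann eigenvalues in increasing order, indexed by `m = 0, 1, 2, …`. -/
noncomputable def neumannEigenvalue (μ : Measure ℝ) (m : ℕ) : ℝ :=
  nthLeast (neumannSpectrum μ) m

/-- The Dirichlet eigenvalues in increasing order, indexed by `m = 1, 2, 3, …`
(the value at `m = 0` has no meaning). -/
noncomputable def dirichletEigenvalue (μ : Measure ℝ) (m : ℕ) : ℝ :=
  nthLeast (dirichletSpectrum μ) (m - 1)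

/-- The supremum distance on `[0,1]` of the distribution functions of `μ` and `ν`. -/
noncomputable def cdfDist (μ ν : Measure ℝ) : ℝ :=
  ⨆ x : Icc (0 : ℝ) 1, |cdf μ x - cdf ν x|

/-- `μ` is a non-atomic Borel probability measure on `[0,1]`
(regarded as a measure on `ℝ` that gives no mass to the complement of `[0,1]`). -/
structure IsNonatomicProb (μ : Measure ℝ) : Prop where
  isProbabilityMeasure : IsProbabilityMeasure μ
  nullSingleton : NullSingletonClass μ
  compl_Icc : μ (Icc (0 : ℝ) 1)ᶜ = 0

end KreinFeller

/-! Shooting method. For given initial data `a = u(0)`, `b = u'(0)` the equation becomes the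
Volterra equation `u + l T u = a + b x`, where `T` is the double primitive. Since `‖Tⁿ‖ ≤ 1 / n!`
for every probability measure, it is solved by a Neumann series with bounds that do not depend on
the measure. The eigenvalues are the zeros in `l` of a boundary value at `1`: `u'(1)` with data `(1,
0)` for Neumann, `u(1)` with data `(0, 1)` for Dirichlet.

The Lagrange identity controls these zeros. If `B k = 0`, then `r * B l = (l - k) * I l k`, where
`I` is the `L₂(μ)` inner product of the solutions for `l` and `k`, continuous and positive on the
diagonal (`IsCharacteristic`). So the zeros are simple and isolated, and distinct zeros have
orthogonal solutions. The energy identity makes them nonnegative.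

Integration by parts turns `∫ v dμ - ∫ v dν` for `v` of class `C¹` into an expression in the
distribution functions. Hence `B` and `I` for `ν` differ from those for `μ` by a constant times `‖F
- G‖_∞`, locally uniformly in the parameters. Near a zero `k` of `B`, the perturbed function has a
zero `x` by the intermediate value theorem and only one by orthogonality, and `|x - k|` is of the
order of `B x`, which is the error (`exists_zero_near`). A count of the zeros below a level shows
that `x` keeps the index of `k` (`eventually_encard_zeros_eq`).

That there are infinitely many eigenvalues is Sturm oscillation. For large `l` the solution has many
zeros in `[0,1]`, by concavity; the least parameter with a prescribed number of zeros has one of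
them at `1`; and each solution has finitely many zeros. Zeros of `u'(1)` lie between those of `u(1)`
for the same initial data. -/

open scoped Topology

namespace KreinFeller

/-! ### Neumann series of an operator whose powers decay factorially -/

section QuasiNilpotent

variable {A : Type*} [NormedRing A] [NormedAlgebra ℝ A]

theorem norm_smul_pow_le_of_factorial {T : A} (hT : ∀ n : ℕ, ‖T ^ n‖ ≤ 1 / n.factorial)
    (l : ℝ) (n : ℕ) : ‖(-(l • T)) ^ n‖ ≤ |l| ^ n / n.factorial := by
  rw [← neg_smul, smul_pow, norm_smul, norm_pow, norm_neg, Real.norm_eq_abs]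
  calc |l| ^ n * ‖T ^ n‖ ≤ |l| ^ n * (1 / n.factorial) := by
        gcongr; exact hT n
    _ = _ := by ring

/-- The Neumann series `∑ (-l T)ⁿ`. -/
noncomputable def neumannSeries (T : A) (l : ℝ) : A := ∑' n : ℕ, (-(l • T)) ^ n

theorem norm_neumannSeries_le {T : A} (hT : ∀ n : ℕ, ‖T ^ n‖ ≤ 1 / n.factorial) (l : ℝ) :
    ‖neumannSeries T l‖ ≤ Real.exp |l| := by
  refine tsum_of_norm_bounded ?_ (norm_smul_pow_le_of_factorial hT l)
  rw [Real.exp_eq_exp_ℝ]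
  exact NormedSpace.expSeries_div_hasSum_exp |l|

variable [CompleteSpace A]

theorem summable_smul_pow_of_factorial {T : A} (hT : ∀ n : ℕ, ‖T ^ n‖ ≤ 1 / n.factorial)
    (l : ℝ) : Summable fun n : ℕ => (-(l • T)) ^ n :=
  .of_norm_bounded (Real.summable_pow_div_factorial |l|) (norm_smul_pow_le_of_factorial hT l)

theorem neumannSeries_mul {T : A} (hT : ∀ n : ℕ, ‖T ^ n‖ ≤ 1 / n.factorial) (l : ℝ) :
    neumannSeries T l * (1 + l • T) = 1 := by
  have := (summable_smul_pow_of_factorial hT l).tsum_pow_mul_one_sub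
  rwa [sub_neg_eq_add] at this

theorem mul_neumannSeries {T : A} (hT : ∀ n : ℕ, ‖T ^ n‖ ≤ 1 / n.factorial) (l : ℝ) :
    (1 + l • T) * neumannSeries T l = 1 := by
  have := (summable_smul_pow_of_factorial hT l).one_sub_mul_tsum_pow
  rwa [sub_neg_eq_add] at this

/-- The resolvent identity. It yields the Lipschitz dependence of solutions on the parameter (`T =
S`) and on the measure (`l = k`). -/
theorem neumannSeries_sub {T S : A} (hT : ∀ n : ℕ, ‖T ^ n‖ ≤ 1 / n.factorial)
    (hS : ∀ n : ℕ, ‖S ^ n‖ ≤ 1 / n.factorial) (l k : ℝ) :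
    neumannSeries T l - neumannSeries S k =
      neumannSeries T l * (k • S - l • T) * neumannSeries S k := by
  calc neumannSeries T l - neumannSeries S k
      = neumannSeries T l * ((1 + k • S) * neumannSeries S k) -
          (neumannSeries T l * (1 + l • T)) * neumannSeries S k := by
        rw [mul_neumannSeries hS, neumannSeries_mul hT, mul_one, one_mul]
    _ = _ := by noncomm_ring

end QuasiNilpotent

section BanachSpace

variable {E : Type*} [NormedAddCommGroup E] [NormedSpace ℝ E] [CompleteSpace E]

theorem neumannSeries_apply_add {T : E →L[ℝ] E} (hT : ∀ n : ℕ, ‖T ^ n‖ ≤ 1 / n.factorial)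
    (l : ℝ) (f : E) : neumannSeries T l (f + l • T f) = f :=
  DFunLike.congr_fun (neumannSeries_mul hT l) f

theorem neumannSeries_apply_add_smul {T : E →L[ℝ] E} (hT : ∀ n : ℕ, ‖T ^ n‖ ≤ 1 / n.factorial)
    (l : ℝ) (f : E) : neumannSeries T l f + l • T (neumannSeries T l f) = f :=
  DFunLike.congr_fun (mul_neumannSeries hT l) f

theorem neumannSeries_sub_apply {T S : E →L[ℝ] E} (hT : ∀ n : ℕ, ‖T ^ n‖ ≤ 1 / n.factorial)
    (hS : ∀ n : ℕ, ‖S ^ n‖ ≤ 1 / n.factorial) (l k : ℝ) (f : E) :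
    neumannSeries T l f - neumannSeries S k f =
      neumannSeries T l (k • S (neumannSeries S k f) - l • T (neumannSeries S k f)) :=
  DFunLike.congr_fun (neumannSeries_sub hT hS l k) f

end BanachSpace

/-! ### The Volterra operator of the measure and its inverse -/

section Volterra

theorem abs_integral_measure_le (μ : Measure ℝ) [IsProbabilityMeasure μ] {f : ℝ → ℝ} {M x : ℝ} (hM : 0 ≤ M) (hx : 0 ≤ x)
    (h : ∀ y ∈ Icc 0 x, |f y| ≤ M) : |∫ y in (0 : ℝ)..x, f y ∂μ| ≤ M := by
  rw [intervalIntegral.integral_of_le hx, ← Real.norm_eq_abs]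
  calc ‖∫ y in Ioc 0 x, f y ∂μ‖ ≤ M * μ.real (Ioc 0 x) :=
        norm_setIntegral_le_of_norm_le_const (measure_lt_top _ _)
          fun y hy => h y ⟨hy.1.le, hy.2⟩
    _ ≤ M * 1 := by gcongr; exact measureReal_le_one
    _ = M := mul_one M

variable (μ : Measure ℝ) [IsProbabilityMeasure μ] [NullSingletonClass μ]

theorem continuous_integral_measure {f : ℝ → ℝ} (hf : Continuous f) :
    Continuous fun x => ∫ y in (0 : ℝ)..x, f y ∂μ :=
  intervalIntegral.continuous_primitive (fun a b => hf.intervalIntegrable a b) 0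

/-- The double primitive `x ↦ ∫₀ˣ ∫₀ʸ f dμ dy`. -/
noncomputable def doublePrim (f : ℝ → ℝ) (x : ℝ) : ℝ :=
  ∫ y in (0 : ℝ)..x, ∫ t in (0 : ℝ)..y, f t ∂μ

theorem hasDerivAt_doublePrim {f : ℝ → ℝ} (hf : Continuous f) (x : ℝ) :
    HasDerivAt (doublePrim μ f) (∫ t in (0 : ℝ)..x, f t ∂μ) x :=
  (continuous_integral_measure μ hf).integral_hasStrictDerivAt 0 x |>.hasDerivAt

theorem continuous_doublePrim {f : ℝ → ℝ} (hf : Continuous f) : Continuous (doublePrim μ f) :=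
  continuous_iff_continuousAt.2 fun x => (hasDerivAt_doublePrim μ hf x).continuousAt

/-- The integral against `μ` only preserves a monotone bound, because the mass is at most `1`; the
Lebesgue integral gains one power and the factorial. -/
theorem abs_doublePrim_le {f : ℝ → ℝ} {M : ℝ} (n : ℕ) (hf : Continuous f)
    (hM : 0 ≤ M) (h : ∀ y ∈ Icc (0 : ℝ) 1, |f y| ≤ M * (y ^ n / n.factorial)) :
    ∀ x ∈ Icc (0 : ℝ) 1, |doublePrim μ f x| ≤ M * (x ^ (n + 1) / (n + 1).factorial) := by
  intro x hx
  have hpt : ∀ y ∈ Icc (0 : ℝ) x, |∫ t in (0 : ℝ)..y, f t ∂μ| ≤ M * (y ^ n / n.factorial) := by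
    intro y hy
    have hy0 := hy.1
    refine abs_integral_measure_le μ (by positivity) hy.1 fun t ht => ?_
    have ht0 := ht.1
    refine (h t ⟨ht.1, ht.2.trans (hy.2.trans hx.2)⟩).trans ?_
    gcongr
    exact ht.2
  have hc := continuous_integral_measure μ hf
  calc |doublePrim μ f x| ≤ ∫ y in (0 : ℝ)..x, |∫ t in (0 : ℝ)..y, f t ∂μ| :=
        intervalIntegral.abs_integral_le_integral_abs hx.1
    _ ≤ ∫ y in (0 : ℝ)..x, M * (y ^ n / n.factorial) :=
        intervalIntegral.integral_mono_on hx.1 (hc.abs.intervalIntegrable _ _)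
          ((by fun_prop : Continuous fun y : ℝ => M * (y ^ n / n.factorial)).intervalIntegrable _ _)
          hpt
    _ = M * (x ^ (n + 1) / (n + 1).factorial) := by
        rw [intervalIntegral.integral_const_mul, intervalIntegral.integral_div, integral_pow,
          Nat.factorial_succ]
        push_cast
        field_simp
        simp

/-- The Volterra operator `f ↦ ∫₀ˣ ∫₀ʸ f dμ dy` on `C([0,1])`. -/
noncomputable def volterra : C(Icc (0 : ℝ) 1, ℝ) →L[ℝ] C(Icc (0 : ℝ) 1, ℝ) :=
  LinearMap.mkContinuous
    { toFun := fun f => ⟨fun x => doublePrim μ (f.IccExtend zero_le_one) x,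
        (continuous_doublePrim μ (f.IccExtend zero_le_one).continuous).comp continuous_subtype_val⟩
      map_add' := by
        intro f g
        ext x
        have hf := (f.IccExtend zero_le_one).continuous
        have hg := (g.IccExtend zero_le_one).continuous
        have h : ∀ y, ∫ t in (0 : ℝ)..y, (f + g).IccExtend zero_le_one t ∂μ =
            (∫ t in (0 : ℝ)..y, f.IccExtend zero_le_one t ∂μ) +
              ∫ t in (0 : ℝ)..y, g.IccExtend zero_le_one t ∂μ := fun y =>
          intervalIntegral.integral_add (hf.intervalIntegrable _ _) (hg.intervalIntegrable _ _)
        simp only [doublePrim, h, ContinuousMap.coe_mk, ContinuousMap.add_apply]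
        exact intervalIntegral.integral_add
          ((continuous_integral_measure μ hf).intervalIntegrable _ _)
          ((continuous_integral_measure μ hg).intervalIntegrable _ _)
      map_smul' := by
        intro c f
        ext x
        have h : ∀ y, ∫ t in (0 : ℝ)..y, (c • f).IccExtend zero_le_one t ∂μ =
            c * ∫ t in (0 : ℝ)..y, f.IccExtend zero_le_one t ∂μ := fun y =>
          intervalIntegral.integral_const_mul _ _
        simp only [doublePrim, h, ContinuousMap.coe_mk, ContinuousMap.smul_apply, RingHom.id_apply,
          smul_eq_mul]
        exact intervalIntegral.integral_const_mul _ _ } 1 (by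
    intro f
    rw [one_mul, ContinuousMap.norm_le _ (norm_nonneg f)]
    intro x
    have h := abs_doublePrim_le μ (M := ‖f‖) 0 (f.IccExtend zero_le_one).continuous
      (norm_nonneg f) (fun y hy => by
        simpa [IccExtend] using f.norm_coe_le_norm _) x x.2
    refine h.trans ?_
    simp only [zero_add, pow_one, Nat.factorial_one, Nat.cast_one, div_one]
    exact mul_le_of_le_one_right (norm_nonneg f) x.2.2)

theorem volterra_apply (f : C(Icc (0 : ℝ) 1, ℝ)) (x : Icc (0 : ℝ) 1) :
    volterra μ f x = doublePrim μ (f.IccExtend zero_le_one) x := rfl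

theorem norm_volterra_pow_le (n : ℕ) : ‖volterra μ ^ n‖ ≤ 1 / n.factorial := by
  refine ContinuousLinearMap.opNorm_le_bound _ (by positivity) fun f => ?_
  -- The factorial comes from iterating a pointwise bound in `x`; submultiplicativity of the norm
  -- would give only `1`.
  have key : ∀ x ∈ Icc (0 : ℝ) 1,
      |((volterra μ ^ n) f).IccExtend zero_le_one x| ≤ ‖f‖ * (x ^ n / n.factorial) := by
    induction n with
    | zero =>
      intro x hx
      simpa [IccExtend] using f.norm_coe_le_norm _
    | succ n ih =>
      intro x hx
      rw [pow_succ']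
      have := abs_doublePrim_le μ n (((volterra μ ^ n) f).IccExtend zero_le_one).continuous
        (norm_nonneg f) ih x hx
      have e : ((volterra μ * volterra μ ^ n) f).IccExtend zero_le_one x =
          doublePrim μ (((volterra μ ^ n) f).IccExtend zero_le_one) x := by
        rw [ContinuousMap.coe_IccExtend, IccExtend_of_mem _ _ hx]
        rfl
      rwa [e]
  rw [ContinuousMap.norm_le _ (by positivity)]
  intro x
  have h := key x x.2
  rw [ContinuousMap.coe_IccExtend, IccExtend_val] at h
  refine h.trans ?_
  rw [mul_comm]
  gcongr
  exact pow_le_one₀ x.2.1 x.2.2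

theorem norm_volterra_le : ‖volterra μ‖ ≤ 1 := by
  simpa using norm_volterra_pow_le μ 1

/-- The inverse of `1 + l T`, where `T` is the Volterra operator. -/
noncomputable def volterraInv (l : ℝ) : C(Icc (0 : ℝ) 1, ℝ) →L[ℝ] C(Icc (0 : ℝ) 1, ℝ) :=
  neumannSeries (volterra μ) l

theorem volterraInv_apply_add (l : ℝ) (f : C(Icc (0 : ℝ) 1, ℝ)) :
    volterraInv μ l (f + l • volterra μ f) = f :=
  neumannSeries_apply_add (norm_volterra_pow_le μ) l f

theorem volterraInv_add_volterra (l : ℝ) (f : C(Icc (0 : ℝ) 1, ℝ)) :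
    volterraInv μ l f + l • volterra μ (volterraInv μ l f) = f :=
  neumannSeries_apply_add_smul (norm_volterra_pow_le μ) l f

theorem norm_volterraInv_le (l : ℝ) : ‖volterraInv μ l‖ ≤ Real.exp |l| :=
  norm_neumannSeries_le (norm_volterra_pow_le μ) l

theorem volterraInv_sub_apply (ν : Measure ℝ) [IsProbabilityMeasure ν] [NullSingletonClass ν]
    (l k : ℝ) (f : C(Icc (0 : ℝ) 1, ℝ)) :
    volterraInv ν l f - volterraInv μ k f =
      volterraInv ν l (k • volterra μ (volterraInv μ k f) - l • volterra ν (volterraInv μ k f)) :=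
  neumannSeries_sub_apply (norm_volterra_pow_le ν) (norm_volterra_pow_le μ) l k f

end Volterra

/-! ### Integration by parts against the measure -/

section IntegrationByParts

variable (μ : Measure ℝ) [IsProbabilityMeasure μ]

/-- Fubini for `v' t * g y` on the triangle `y ≤ t`: one order gives the integral of `v'` times the
primitive of `g`, the other gives `(v x - v y) * g y`. -/
theorem integral_mul_eq_sub {g v v' : ℝ → ℝ} (hg : Continuous g)
    (hv : ∀ x, HasDerivAt v (v' x) x) (hv' : Continuous v') {x : ℝ} (hx : 0 ≤ x) :
    ∫ y in (0 : ℝ)..x, v y * g y ∂μ =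
      v x * (∫ y in (0 : ℝ)..x, g y ∂μ) -
        ∫ t in (0 : ℝ)..x, v' t * ∫ y in (0 : ℝ)..t, g y ∂μ := by
  have hvc : Continuous v := continuous_iff_continuousAt.2 fun x => (hv x).continuousAt
  have hgi : IntegrableOn g (Ioc 0 x) μ := (hg.intervalIntegrable 0 x).1
  have hvi : IntegrableOn v' (Ioc 0 x) := (hv'.intervalIntegrable 0 x).1
  have hms : MeasurableSet {p : ℝ × ℝ | p.2 ≤ p.1} :=
    measurableSet_le measurable_snd measurable_fst
  have hint : Integrable (Function.uncurry fun t y : ℝ =>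
      {p : ℝ × ℝ | p.2 ≤ p.1}.indicator (fun p => v' p.1 * g p.2) (t, y))
      ((volume.restrict (Ioc 0 x)).prod (μ.restrict (Ioc 0 x))) := by
    have := (Integrable.mul_prod hvi hgi).indicator hms
    exact this
  have hswap := integral_integral_swap hint
  have hleft : ∫ t in Ioc 0 x, ∫ y in Ioc 0 x,
      {p : ℝ × ℝ | p.2 ≤ p.1}.indicator (fun p => v' p.1 * g p.2) (t, y) ∂μ =
      ∫ t in (0 : ℝ)..x, v' t * ∫ y in (0 : ℝ)..t, g y ∂μ := by
    rw [intervalIntegral.integral_of_le hx]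
    refine setIntegral_congr_fun (s := Ioc 0 x) measurableSet_Ioc fun t ht => ?_
    have e : ∀ y, {p : ℝ × ℝ | p.2 ≤ p.1}.indicator (fun p => v' p.1 * g p.2) (t, y) =
        (Iic t).indicator (fun y => v' t * g y) y := fun y => by
      simp [indicator]
    simp only [e]
    rw [setIntegral_indicator (t := Iic t) measurableSet_Iic, Ioc_inter_Iic, min_eq_right ht.2,
      integral_const_mul, intervalIntegral.integral_of_le ht.1.le]
  have hright : ∫ y in Ioc 0 x, (∫ t in Ioc 0 x,
      {p : ℝ × ℝ | p.2 ≤ p.1}.indicator (fun p => v' p.1 * g p.2) (t, y)) ∂μ =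
      ∫ y in (0 : ℝ)..x, (v x - v y) * g y ∂μ := by
    rw [intervalIntegral.integral_of_le hx]
    refine setIntegral_congr_fun (s := Ioc 0 x) measurableSet_Ioc fun y hy => ?_
    have e : ∀ t, {p : ℝ × ℝ | p.2 ≤ p.1}.indicator (fun p => v' p.1 * g p.2) (t, y) =
        (Ici y).indicator (fun t => v' t * g y) t := fun t => by
      simp [indicator]
    simp only [e]
    rw [setIntegral_indicator measurableSet_Ici]
    have hs : Ioc 0 x ∩ Ici y = Icc y x := by
      ext t
      simp only [mem_inter_iff, mem_Ioc, mem_Ici, mem_Icc]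
      exact ⟨fun h => ⟨h.2, h.1.2⟩, fun h => ⟨⟨hy.1.trans_le h.1, h.2⟩, h.1⟩⟩
    rw [hs, integral_mul_const, integral_Icc_eq_integral_Ioc,
      ← intervalIntegral.integral_of_le hy.2,
      intervalIntegral.integral_eq_sub_of_hasDerivAt (fun t _ => hv t)
        (hv'.intervalIntegrable _ _)]
  rw [hleft, hright] at hswap
  have hvg : Continuous fun y => v y * g y := hvc.mul hg
  rw [hswap]
  have : ∫ y in (0 : ℝ)..x, (v x - v y) * g y ∂μ =
      v x * (∫ y in (0 : ℝ)..x, g y ∂μ) - ∫ y in (0 : ℝ)..x, v y * g y ∂μ := by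
    simp only [sub_mul]
    rw [intervalIntegral.integral_sub ((hg.const_mul _).intervalIntegrable _ _)
      (hvg.intervalIntegrable _ _), intervalIntegral.integral_const_mul]
  rw [this]
  ring

/-- Integration by parts with `g = 1` leaves only distribution functions on the right. This is the
source of the linear rate, and the reason why `C¹` bounds on the integrand are needed. -/
theorem abs_integral_sub_integral_le [NullSingletonClass μ] (ν : Measure ℝ)
    [IsProbabilityMeasure ν] [NullSingletonClass ν] {ε : ℝ}
    (hε : ∀ t ∈ Icc (0 : ℝ) 1, |(∫ _ in (0 : ℝ)..t, (1 : ℝ) ∂μ) - ∫ _ in (0 : ℝ)..t, (1 : ℝ) ∂ν| ≤ ε)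
    {v v' : ℝ → ℝ} {A A' : ℝ} (hA' : 0 ≤ A')
    (hv : ∀ x, HasDerivAt v (v' x) x) (hv' : Continuous v')
    (hvA : ∀ x ∈ Icc (0 : ℝ) 1, |v x| ≤ A) (hvA' : ∀ x ∈ Icc (0 : ℝ) 1, |v' x| ≤ A')
    {x : ℝ} (hx : x ∈ Icc (0 : ℝ) 1) :
    |(∫ y in (0 : ℝ)..x, v y ∂μ) - ∫ y in (0 : ℝ)..x, v y ∂ν| ≤ (A + A') * ε := by
  have hε0 : 0 ≤ ε := (abs_nonneg _).trans (hε x hx)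
  have hμ := integral_mul_eq_sub μ (continuous_const (y := (1 : ℝ))) hv hv' hx.1
  have hν := integral_mul_eq_sub ν (continuous_const (y := (1 : ℝ))) hv hv' hx.1
  simp only [mul_one] at hμ hν
  have hcμ : Continuous fun t => v' t * ∫ _ in (0 : ℝ)..t, (1 : ℝ) ∂μ := hv'.mul
    (continuous_integral_measure μ (continuous_const (y := (1 : ℝ))))
  have hcν : Continuous fun t => v' t * ∫ _ in (0 : ℝ)..t, (1 : ℝ) ∂ν := hv'.mul
    (continuous_integral_measure ν (continuous_const (y := (1 : ℝ))))
  have e : (∫ y in (0 : ℝ)..x, v y ∂μ) - ∫ y in (0 : ℝ)..x, v y ∂ν =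
      v x * ((∫ _ in (0 : ℝ)..x, (1 : ℝ) ∂μ) - ∫ _ in (0 : ℝ)..x, (1 : ℝ) ∂ν) -
      ∫ t in (0 : ℝ)..x, v' t *
        ((∫ _ in (0 : ℝ)..t, (1 : ℝ) ∂μ) - ∫ _ in (0 : ℝ)..t, (1 : ℝ) ∂ν) := by
    rw [hμ, hν]
    simp only [mul_sub]
    rw [intervalIntegral.integral_sub (hcμ.intervalIntegrable _ _) (hcν.intervalIntegrable _ _)]
    ring
  rw [e, add_mul]
  refine (abs_sub _ _).trans (add_le_add ?_ ?_)
  · rw [abs_mul]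
    exact mul_le_mul (hvA x hx) (hε x hx) (abs_nonneg _) ((abs_nonneg _).trans (hvA x hx))
  · have := intervalIntegral.norm_integral_le_of_norm_le_const (a := (0 : ℝ)) (b := x)
      (C := A' * ε) (f := fun t => v' t *
        ((∫ _ in (0 : ℝ)..t, (1 : ℝ) ∂μ) - ∫ _ in (0 : ℝ)..t, (1 : ℝ) ∂ν)) (by
        intro t ht
        rw [uIoc_of_le hx.1] at ht
        have ht' : t ∈ Icc (0 : ℝ) 1 := ⟨ht.1.le, ht.2.trans hx.2⟩
        rw [norm_mul]
        exact mul_le_mul (hvA' t ht') (hε t ht') (abs_nonneg _) hA')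
    rw [sub_zero, abs_of_nonneg hx.1] at this
    exact this.trans (mul_le_of_le_one_right (mul_nonneg hA' hε0) hx.2)

end IntegrationByParts

/-! ### Solutions of the initial value problem, with bounds free of the measure -/

section Solutions

/-- The affine function `x ↦ a + b x` on `[0,1]`. -/
noncomputable def affine (a b : ℝ) : C(Icc (0 : ℝ) 1, ℝ) := ⟨fun x => a + b * x, by fun_prop⟩

theorem norm_affine_le (a b : ℝ) : ‖affine a b‖ ≤ |a| + |b| := by
  rw [ContinuousMap.norm_le _ (by positivity)]
  intro x
  have hx := x.2
  calc |a + b * x| ≤ |a| + |b * x| := abs_add_le _ _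
    _ = |a| + |b| * x := by rw [abs_mul, abs_of_nonneg hx.1]
    _ ≤ |a| + |b| * 1 := by gcongr; exact hx.2
    _ = _ := by rw [mul_one]

variable (μ : Measure ℝ) [IsProbabilityMeasure μ] [NullSingletonClass μ] (a b l : ℝ)

/-- The solution on `[0,1]`, constantly extended to `ℝ`, of the initial value problem. -/
noncomputable def solExt : C(ℝ, ℝ) := (volterraInv μ l (affine a b)).IccExtend zero_le_one

/-- The solution `u` of `d/dμ d/dx u = -l u`, `u 0 = a`, `u' 0 = b` on `[0,1]`, extended to a
continuously differentiable function on `ℝ`. -/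
noncomputable def sol (x : ℝ) : ℝ := a + b * x - l * doublePrim μ (solExt μ a b l) x

/-- The derivative of the solution `sol`. -/
noncomputable def dsol (x : ℝ) : ℝ := b - l * ∫ t in (0 : ℝ)..x, solExt μ a b l t ∂μ

theorem hasDerivAt_sol (x : ℝ) : HasDerivAt (sol μ a b l) (dsol μ a b l x) x := by
  have h1 : HasDerivAt (fun x : ℝ => a + b * x) b x := by
    simpa using ((hasDerivAt_id x).const_mul b).const_add a
  exact h1.sub ((hasDerivAt_doublePrim μ (solExt μ a b l).continuous x).const_mul l)

theorem continuous_sol : Continuous (sol μ a b l) :=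
  continuous_iff_continuousAt.2 fun x => (hasDerivAt_sol μ a b l x).continuousAt

theorem continuous_dsol : Continuous (dsol μ a b l) :=
  continuous_const.sub
    (continuous_const.mul (continuous_integral_measure μ (solExt μ a b l).continuous))

theorem sol_zero : sol μ a b l 0 = a := by simp [sol, doublePrim]

theorem dsol_zero : dsol μ a b l 0 = b := by simp [dsol]

variable {l}

theorem sol_eq_volterraInv {x : ℝ} (hx : x ∈ Icc (0 : ℝ) 1) :
    sol μ a b l x = volterraInv μ l (affine a b) ⟨x, hx⟩ := by
  have h := DFunLike.congr_fun (volterraInv_add_volterra μ l (affine a b)) ⟨x, hx⟩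
  simp only [ContinuousMap.add_apply, ContinuousMap.smul_apply, volterra_apply, smul_eq_mul] at h
  rw [sol, sub_eq_iff_eq_add]
  exact h.symm

theorem solExt_eq_sol {x : ℝ} (hx : x ∈ Icc (0 : ℝ) 1) : solExt μ a b l x = sol μ a b l x := by
  rw [sol_eq_volterraInv μ a b hx, solExt, ContinuousMap.coe_IccExtend, IccExtend_of_mem _ _ hx]

theorem integral_congr_of_mem_Icc {f g : ℝ → ℝ} (h : ∀ x ∈ Icc (0 : ℝ) 1, f x = g x) {x : ℝ}
    (hx : x ∈ Icc (0 : ℝ) 1) (ρ : Measure ℝ) :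
    ∫ t in (0 : ℝ)..x, f t ∂ρ = ∫ t in (0 : ℝ)..x, g t ∂ρ := by
  refine intervalIntegral.integral_congr fun t ht => ?_
  rw [uIcc_of_le hx.1] at ht
  exact h t ⟨ht.1, ht.2.trans hx.2⟩

theorem dsol_eq {x : ℝ} (hx : x ∈ Icc (0 : ℝ) 1) :
    dsol μ a b l x = b - l * ∫ t in (0 : ℝ)..x, sol μ a b l t ∂μ := by
  rw [dsol, integral_congr_of_mem_Icc (fun y hy => solExt_eq_sol μ a b hy) hx]

/-- Uniqueness for the Volterra equation: `volterraInv` is also a left inverse of `1 + l T`. -/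
theorem eq_sol_of_integral_eq {f : ℝ → ℝ} (hf : ContinuousOn f (Icc 0 1))
    (h : ∀ x ∈ Icc (0 : ℝ) 1, f x = a + b * x - l * doublePrim μ f x) {x : ℝ}
    (hx : x ∈ Icc (0 : ℝ) 1) : f x = sol μ a b l x := by
  set F : C(Icc (0 : ℝ) 1, ℝ) := ⟨(Icc (0 : ℝ) 1).domRestrict f, hf.domRestrict⟩
  have hF : ∀ y ∈ Icc (0 : ℝ) 1, F.IccExtend zero_le_one y = f y := fun y hy => by
    rw [ContinuousMap.coe_IccExtend, IccExtend_of_mem _ _ hy]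
    rfl
  have key : F + l • volterra μ F = affine a b := by
    ext ⟨y, hy⟩
    have hd : doublePrim μ (F.IccExtend zero_le_one) y = doublePrim μ f y :=
      integral_congr_of_mem_Icc (fun z hz => integral_congr_of_mem_Icc hF hz μ) hy _
    simp only [ContinuousMap.add_apply, ContinuousMap.smul_apply, volterra_apply, smul_eq_mul, hd]
    change f y + _ = a + b * y
    rw [h y hy]
    ring
  rw [sol_eq_volterraInv μ a b hx, ← key, volterraInv_apply_add]
  rfl

/-- A bound for the solutions with `|l| ≤ R`. -/
noncomputable def solBound (R : ℝ) : ℝ := (|a| + |b|) * Real.exp R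

/-- A bound for the derivatives of the solutions with `|l| ≤ R`. -/
noncomputable def dsolBound (R : ℝ) : ℝ := |b| + R * solBound a b R

theorem solBound_nonneg (R : ℝ) : 0 ≤ solBound a b R := by
  unfold solBound; positivity

variable {R : ℝ}

theorem dsolBound_nonneg (hR : 0 ≤ R) : 0 ≤ dsolBound a b R := by
  have := solBound_nonneg a b R
  unfold dsolBound; positivity

theorem norm_volterraInv_affine_le (hl : |l| ≤ R) :
    ‖volterraInv μ l (affine a b)‖ ≤ solBound a b R := by
  calc ‖volterraInv μ l (affine a b)‖ ≤ ‖volterraInv μ l‖ * ‖affine a b‖ := ContinuousLinearMap.le_opNorm _ _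
    _ ≤ Real.exp R * (|a| + |b|) := by
        gcongr
        · exact (norm_volterraInv_le μ l).trans (Real.exp_le_exp.2 hl)
        · exact norm_affine_le a b
    _ = _ := mul_comm _ _

theorem abs_sol_le (hl : |l| ≤ R) {x : ℝ} (hx : x ∈ Icc (0 : ℝ) 1) :
    |sol μ a b l x| ≤ solBound a b R := by
  rw [sol_eq_volterraInv μ a b hx]
  exact (ContinuousMap.norm_coe_le_norm _ _).trans (norm_volterraInv_affine_le μ a b hl)

theorem abs_dsol_le (hl : |l| ≤ R) {x : ℝ} (hx : x ∈ Icc (0 : ℝ) 1) :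
    |dsol μ a b l x| ≤ dsolBound a b R := by
  rw [dsol_eq μ a b hx]
  refine (abs_sub _ _).trans ?_
  rw [abs_mul, dsolBound]
  gcongr
  · exact (abs_nonneg _).trans hl
  · exact abs_integral_measure_le μ (solBound_nonneg a b R) hx.1 fun y hy =>
      abs_sol_le μ a b hl ⟨hy.1, hy.2.trans hx.2⟩

variable {k : ℝ}

theorem abs_sol_sub_sol_le (hl : |l| ≤ R) (hk : |k| ≤ R) {x : ℝ} (hx : x ∈ Icc (0 : ℝ) 1) :
    |sol μ a b l x - sol μ a b k x| ≤ Real.exp R * solBound a b R * |l - k| := by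
  have h := volterraInv_sub_apply μ μ l k (affine a b)
  rw [← sub_smul] at h
  rw [sol_eq_volterraInv μ a b hx, sol_eq_volterraInv μ a b hx]
  refine (ContinuousMap.norm_coe_le_norm
    (volterraInv μ l (affine a b) - volterraInv μ k (affine a b)) ⟨x, hx⟩).trans ?_
  rw [h]
  calc ‖volterraInv μ l ((k - l) • volterra μ (volterraInv μ k (affine a b)))‖
      ≤ ‖volterraInv μ l‖ * (‖k - l‖ * (‖volterra μ‖ * ‖volterraInv μ k (affine a b)‖)) := by
        refine (ContinuousLinearMap.le_opNorm _ _).trans ?_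
        rw [norm_smul]
        gcongr
        exact ContinuousLinearMap.le_opNorm _ _
    _ ≤ Real.exp R * (|l - k| * (1 * solBound a b R)) := by
        gcongr
        · exact (norm_volterraInv_le μ l).trans (Real.exp_le_exp.2 hl)
        · rw [Real.norm_eq_abs, abs_sub_comm]
        · exact norm_volterra_le μ
        · exact norm_volterraInv_affine_le μ a b hk
    _ = _ := by ring

theorem abs_dsol_sub_dsol_le (hl : |l| ≤ R) (hk : |k| ≤ R) {x : ℝ} (hx : x ∈ Icc (0 : ℝ) 1) :
    |dsol μ a b l x - dsol μ a b k x| ≤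
      (R * (Real.exp R * solBound a b R) + solBound a b R) * |l - k| := by
  have e : dsol μ a b l x - dsol μ a b k x =
      -(l * ∫ t in (0 : ℝ)..x, (sol μ a b l t - sol μ a b k t) ∂μ) -
        (l - k) * ∫ t in (0 : ℝ)..x, sol μ a b k t ∂μ := by
    rw [dsol_eq μ a b hx, dsol_eq μ a b hx, intervalIntegral.integral_sub
      ((continuous_sol μ a b l).intervalIntegrable _ _)
      ((continuous_sol μ a b k).intervalIntegrable _ _)]
    ring
  have hR : 0 ≤ R := (abs_nonneg _).trans hl
  have hB := solBound_nonneg a b R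
  rw [e]
  refine (abs_sub _ _).trans ?_
  rw [abs_neg, abs_mul, abs_mul]
  have h1 : |∫ t in (0 : ℝ)..x, (sol μ a b l t - sol μ a b k t) ∂μ| ≤
      Real.exp R * solBound a b R * |l - k| :=
    abs_integral_measure_le μ (by positivity) hx.1 fun y hy =>
      abs_sol_sub_sol_le μ a b hl hk ⟨hy.1, hy.2.trans hx.2⟩
  have h2 : |∫ t in (0 : ℝ)..x, sol μ a b k t ∂μ| ≤ solBound a b R :=
    abs_integral_measure_le μ hB hx.1 fun y hy => abs_sol_le μ a b hk ⟨hy.1, hy.2.trans hx.2⟩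
  calc _ ≤ R * (Real.exp R * solBound a b R * |l - k|) + |l - k| * solBound a b R := by gcongr
    _ = _ := by ring

end Solutions

/-! ### Green and Lagrange identities -/

section Lagrange

variable (μ : Measure ℝ) [IsProbabilityMeasure μ] [NullSingletonClass μ]

/-- Green's first identity, from integration by parts with `l ∫ u₁ dμ = b₁ - u₁'`. Its last term is
symmetric in the two solutions, so antisymmetrizing gives the Lagrange identity; for equal solutions
it is the energy. -/
theorem dsol_mul_sol_eq (a₁ b₁ l a₂ b₂ k : ℝ) {x : ℝ} (hx : x ∈ Icc (0 : ℝ) 1) :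
    dsol μ a₁ b₁ l x * sol μ a₂ b₂ k x =
      b₁ * a₂ - l * (∫ t in (0 : ℝ)..x, sol μ a₁ b₁ l t * sol μ a₂ b₂ k t ∂μ) +
        ∫ t in (0 : ℝ)..x, dsol μ a₁ b₁ l t * dsol μ a₂ b₂ k t := by
  have h := integral_mul_eq_sub μ (continuous_sol μ a₁ b₁ l) (hasDerivAt_sol μ a₂ b₂ k)
    (continuous_dsol μ a₂ b₂ k) hx.1
  have hc1 := continuous_dsol μ a₁ b₁ l
  have hc2 := continuous_dsol μ a₂ b₂ k
  have hp : ∀ t ∈ Icc (0 : ℝ) 1, l * ∫ y in (0 : ℝ)..t, sol μ a₁ b₁ l y ∂μ = b₁ - dsol μ a₁ b₁ l t :=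
    fun t ht => by rw [dsol_eq μ a₁ b₁ ht]; ring
  have h2 : l * (∫ t in (0 : ℝ)..x, dsol μ a₂ b₂ k t * ∫ y in (0 : ℝ)..t, sol μ a₁ b₁ l y ∂μ) =
      b₁ * (sol μ a₂ b₂ k x - a₂) - ∫ t in (0 : ℝ)..x, dsol μ a₁ b₁ l t * dsol μ a₂ b₂ k t := by
    rw [← intervalIntegral.integral_const_mul]
    have e : ∀ t ∈ Icc (0 : ℝ) 1,
        l * (dsol μ a₂ b₂ k t * ∫ y in (0 : ℝ)..t, sol μ a₁ b₁ l y ∂μ) =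
          b₁ * dsol μ a₂ b₂ k t - dsol μ a₁ b₁ l t * dsol μ a₂ b₂ k t := fun t ht => by
      linear_combination (dsol μ a₂ b₂ k t) * hp t ht
    rw [integral_congr_of_mem_Icc e hx, intervalIntegral.integral_sub
      ((hc2.const_mul _).intervalIntegrable _ _)
      ((by fun_prop : Continuous fun t => dsol μ a₁ b₁ l t * dsol μ a₂ b₂ k t).intervalIntegrable
        _ _), intervalIntegral.integral_const_mul,
      intervalIntegral.integral_eq_sub_of_hasDerivAt (fun t _ => hasDerivAt_sol μ a₂ b₂ k t)
        (hc2.intervalIntegrable _ _), sol_zero]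
  have h3 : ∫ t in (0 : ℝ)..x, sol μ a₁ b₁ l t * sol μ a₂ b₂ k t ∂μ =
      ∫ t in (0 : ℝ)..x, sol μ a₂ b₂ k t * sol μ a₁ b₁ l t ∂μ := by
    simp only [mul_comm]
  rw [h3]
  linear_combination l * h - h2 + sol μ a₂ b₂ k x * hp x hx

theorem lagrange_identity (a₁ b₁ l a₂ b₂ k : ℝ) {x : ℝ} (hx : x ∈ Icc (0 : ℝ) 1) :
    dsol μ a₁ b₁ l x * sol μ a₂ b₂ k x - sol μ a₁ b₁ l x * dsol μ a₂ b₂ k x =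
      b₁ * a₂ - a₁ * b₂ + (k - l) * ∫ t in (0 : ℝ)..x, sol μ a₁ b₁ l t * sol μ a₂ b₂ k t ∂μ := by
  have h1 := dsol_mul_sol_eq μ a₁ b₁ l a₂ b₂ k hx
  have h2 := dsol_mul_sol_eq μ a₂ b₂ k a₁ b₁ l hx
  simp only [mul_comm (sol μ a₂ b₂ k _) (sol μ a₁ b₁ l _),
    mul_comm (dsol μ a₂ b₂ k _) (dsol μ a₁ b₁ l _)] at h2
  linear_combination h1 - h2

/-- For equal parameters the Wronskian is constant. Against the solution with data `(-b, a)` it is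
`-(a² + b²)`, so `u` and `u'` have no common zero. -/
theorem sol_ne_zero_or_dsol_ne_zero {a b : ℝ} (hab : a ≠ 0 ∨ b ≠ 0) (l : ℝ) {x : ℝ}
    (hx : x ∈ Icc (0 : ℝ) 1) : sol μ a b l x ≠ 0 ∨ dsol μ a b l x ≠ 0 := by
  by_contra! h
  have h1 := lagrange_identity μ a b l (-b) a l hx
  rw [h.1, h.2] at h1
  rcases hab with h2 | h2
  · have := sq_pos_of_ne_zero h2
    nlinarith [sq_nonneg b]
  · have := sq_pos_of_ne_zero h2
    nlinarith [sq_nonneg a]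

/-- The `L₂(μ)` inner product of two solutions with the same initial data. -/
noncomputable def solInner (a b l k : ℝ) : ℝ :=
  ∫ t in (0 : ℝ)..1, sol μ a b l t * sol μ a b k t ∂μ

variable {μ} in
-- If the norm were zero, then `u = 0` almost everywhere, the integral term in the equation would
-- vanish and `u` would be affine and nonzero. Its zero set has at most one point, which cannot
-- carry a non-atomic probability measure.
theorem solInner_self_pos (hμ : μ (Icc (0 : ℝ) 1)ᶜ = 0) {a b : ℝ} (hab : a ≠ 0 ∨ b ≠ 0) (l : ℝ) :
    0 < solInner μ a b l l := by
  have hc := continuous_sol μ a b l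
  have hnn : 0 ≤ solInner μ a b l l :=
    intervalIntegral.integral_nonneg zero_le_one fun t _ => mul_self_nonneg _
  refine lt_of_le_of_ne hnn fun h0 => ?_
  rw [solInner, intervalIntegral.integral_of_le zero_le_one, eq_comm,
    integral_eq_zero_iff_of_nonneg (fun t => mul_self_nonneg _)
      ((hc.mul hc).intervalIntegrable 0 1).1] at h0
  have hz : ∀ᵐ t ∂μ, t ∈ Ioc (0 : ℝ) 1 → sol μ a b l t = 0 := by
    rw [Filter.EventuallyEq, ae_restrict_iff' measurableSet_Ioc] at h0
    filter_upwards [h0] with t ht htI using mul_self_eq_zero.1 (ht htI)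
  have hprim : ∀ x ∈ Icc (0 : ℝ) 1, ∫ t in (0 : ℝ)..x, solExt μ a b l t ∂μ = 0 := by
    intro x hx
    refine intervalIntegral.integral_zero_ae ?_
    filter_upwards [hz] with t ht htx
    rw [uIoc_of_le hx.1] at htx
    have ht1 := htx.2.trans hx.2
    rw [solExt_eq_sol μ a b ⟨htx.1.le, ht1⟩, ht ⟨htx.1, ht1⟩]
  have haff : ∀ x ∈ Icc (0 : ℝ) 1, sol μ a b l x = a + b * x := by
    intro x hx
    rw [sol, doublePrim, integral_congr_of_mem_Icc (g := fun _ => 0) hprim hx]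
    simp
  have hsub : {t : ℝ | a + b * t = 0}.Subsingleton := by
    intro s hs t ht
    rw [mem_ofPred_eq] at hs ht
    have hb : b ≠ 0 := by
      rintro rfl
      simp at hs hab
      exact hab hs
    exact mul_left_cancel₀ hb (by linarith)
  have hnull : μ {t : ℝ | a + b * t = 0} = 0 := hsub.measure_zero μ
  have h1 : ∀ᵐ t ∂μ, False := by
    -- The point `0` is discarded separately because interval integrals live on `Ioc 0 1`.
    filter_upwards [hz, mem_ae_iff.2 hμ, measure_eq_zero_iff_ae_notMem.1 hnull,
      measure_eq_zero_iff_ae_notMem.1 (measure_singleton (μ := μ) (0 : ℝ))] with t h1 h2 h3 h4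
    refine h3 ?_
    have : t ≠ 0 := h4
    rw [← haff t h2, h1 ⟨lt_of_le_of_ne h2.1 this.symm, h2.2⟩]
  exact IsProbabilityMeasure.ne_zero μ (by simpa using h1)

variable {μ} in
-- Energy identity: without boundary terms, `l ∫ u² dμ = ∫ u'² dx`.
theorem nonneg_of_boundary (hμ : μ (Icc (0 : ℝ) 1)ᶜ = 0) {a b l : ℝ} (hab : a ≠ 0 ∨ b ≠ 0)
    (h0 : b * a = 0) (h1 : dsol μ a b l 1 * sol μ a b l 1 = 0) : 0 ≤ l := by
  have h := dsol_mul_sol_eq μ a b l a b l (right_mem_Icc.2 zero_le_one)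
  rw [h0, h1] at h
  have hp : 0 < ∫ t in (0 : ℝ)..1, sol μ a b l t * sol μ a b l t ∂μ := solInner_self_pos hμ hab l
  have hd : 0 ≤ ∫ t in (0 : ℝ)..1, dsol μ a b l t * dsol μ a b l t :=
    intervalIntegral.integral_nonneg zero_le_one fun t _ => mul_self_nonneg _
  by_contra! hl
  nlinarith [mul_neg_of_neg_of_pos hl hp]

end Lagrange

/-! ### Continuous dependence on the parameter -/

section Continuity

variable (μ : Measure ℝ) [IsProbabilityMeasure μ] [NullSingletonClass μ] (a b : ℝ)

theorem continuousOn_uncurry_of_lipschitz {φ : ℝ → ℝ → ℝ} (hφ : ∀ l, Continuous (φ l))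
    {C : ℝ → ℝ} (h : ∀ R l k x, |l| ≤ R → |k| ≤ R → x ∈ Icc (0 : ℝ) 1 →
      |φ l x - φ k x| ≤ C R * |l - k|) :
    ContinuousOn (Function.uncurry φ) (univ ×ˢ Icc 0 1) := by
  rintro ⟨l, x⟩ ⟨-, hx⟩
  rw [ContinuousWithinAt, tendsto_iff_dist_tendsto_zero]
  have hlim : Tendsto (fun p : ℝ × ℝ => C (|l| + 1) * |p.1 - l| + |φ l p.2 - φ l x|)
      (𝓝[univ ×ˢ Icc 0 1] (l, x)) (𝓝 0) := by
    have hc : Continuous fun p : ℝ × ℝ => C (|l| + 1) * |p.1 - l| + |φ l p.2 - φ l x| := by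
      have := hφ l
      fun_prop
    have := hc.tendsto (l, x)
    simp only [sub_self, abs_zero, mul_zero, add_zero] at this
    exact this.mono_left nhdsWithin_le_nhds
  refine squeeze_zero' (Eventually.of_forall fun _ => dist_nonneg) ?_ hlim
  have h1 : ∀ᶠ p : ℝ × ℝ in 𝓝[univ ×ˢ Icc 0 1] (l, x), |p.1| ≤ |l| + 1 := by
    have hc : ContinuousAt (fun p : ℝ × ℝ => |p.1|) (l, x) := by fun_prop
    have := hc.eventually_lt continuousAt_const (show |l| < |l| + 1 by linarith)
    exact (this.filter_mono nhdsWithin_le_nhds).mono fun p hp => hp.le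
  filter_upwards [h1, self_mem_nhdsWithin] with p hp hpI
  rw [Function.uncurry, Function.uncurry, Real.dist_eq]
  calc |φ p.1 p.2 - φ l x| ≤ |φ p.1 p.2 - φ l p.2| + |φ l p.2 - φ l x| := abs_sub_le _ _ _
    _ ≤ _ := by
      gcongr
      exact h _ _ _ _ hp (by linarith [abs_nonneg l]) hpI.2

theorem continuousOn_sol :
    ContinuousOn (fun p : ℝ × ℝ => sol μ a b p.1 p.2) (univ ×ˢ Icc 0 1) :=
  continuousOn_uncurry_of_lipschitz (C := fun R => Real.exp R * solBound a b R)
    (continuous_sol μ a b) fun _ _ _ _ hl hk hx => abs_sol_sub_sol_le μ a b hl hk hx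

theorem continuousOn_dsol :
    ContinuousOn (fun p : ℝ × ℝ => dsol μ a b p.1 p.2) (univ ×ˢ Icc 0 1) :=
  continuousOn_uncurry_of_lipschitz
    (C := fun R => R * (Real.exp R * solBound a b R) + solBound a b R)
    (continuous_dsol μ a b) fun _ _ _ _ hl hk hx => abs_dsol_sub_dsol_le μ a b hl hk hx

theorem continuous_sol_param {x : ℝ} (hx : x ∈ Icc (0 : ℝ) 1) :
    Continuous fun l => sol μ a b l x :=
  (continuousOn_sol μ a b).comp_continuous (by fun_prop) (f := fun l : ℝ => (l, x))
    fun _ => ⟨mem_univ _, hx⟩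

theorem continuous_dsol_param {x : ℝ} (hx : x ∈ Icc (0 : ℝ) 1) :
    Continuous fun l => dsol μ a b l x :=
  (continuousOn_dsol μ a b).comp_continuous (by fun_prop) (f := fun l : ℝ => (l, x))
    fun _ => ⟨mem_univ _, hx⟩

theorem continuous_solInner : Continuous fun p : ℝ × ℝ => solInner μ a b p.1 p.2 := by
  have hs : ∀ l k, Continuous fun x => sol μ a b l x * sol μ a b k x := fun l k =>
    (continuous_sol μ a b l).mul (continuous_sol μ a b k)
  refine continuous_iff_continuousAt.2 fun ⟨l, k⟩ => ?_
  rw [ContinuousAt, tendsto_iff_dist_tendsto_zero]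
  set R := max |l| |k| + 1 with hR
  set B := solBound a b R
  set K := Real.exp R * B
  have hB : 0 ≤ B := solBound_nonneg a b R
  have hK : 0 ≤ K := mul_nonneg (Real.exp_pos _).le hB
  have hlim : Tendsto (fun p : ℝ × ℝ => K * |p.1 - l| * B + B * (K * |p.2 - k|))
      (𝓝 (l, k)) (𝓝 0) := by
    have hc : Continuous fun p : ℝ × ℝ => K * |p.1 - l| * B + B * (K * |p.2 - k|) := by fun_prop
    simpa using hc.tendsto (l, k)
  refine squeeze_zero' (Eventually.of_forall fun _ => dist_nonneg) ?_ hlim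
  have h1 : ∀ᶠ p : ℝ × ℝ in 𝓝 (l, k), |p.1| < R := by
    have hc : ContinuousAt (fun p : ℝ × ℝ => |p.1|) (l, k) := by fun_prop
    exact hc.eventually_lt continuousAt_const (show |l| < R by linarith [le_max_left |l| |k|])
  have h2 : ∀ᶠ p : ℝ × ℝ in 𝓝 (l, k), |p.2| < R := by
    have hc : ContinuousAt (fun p : ℝ × ℝ => |p.2|) (l, k) := by fun_prop
    exact hc.eventually_lt continuousAt_const (show |k| < R by linarith [le_max_right |l| |k|])
  have hl : |l| ≤ R := by linarith [le_max_left |l| |k|]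
  have hk : |k| ≤ R := by linarith [le_max_right |l| |k|]
  filter_upwards [h1, h2] with p hp1 hp2
  rw [Real.dist_eq, solInner, solInner, ← intervalIntegral.integral_sub
    ((hs _ _).intervalIntegrable _ _) ((hs _ _).intervalIntegrable _ _)]
  refine abs_integral_measure_le μ (by positivity) zero_le_one fun x hx => ?_
  have e : sol μ a b p.1 x * sol μ a b p.2 x - sol μ a b l x * sol μ a b k x =
      (sol μ a b p.1 x - sol μ a b l x) * sol μ a b p.2 x +
        sol μ a b l x * (sol μ a b p.2 x - sol μ a b k x) := by ring
  rw [e]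
  refine (abs_add_le _ _).trans ?_
  rw [abs_mul, abs_mul]
  gcongr
  · exact abs_sol_sub_sol_le μ a b hp1.le hl hx
  · exact abs_sol_le μ a b hp2.le hx
  · exact abs_sol_le μ a b hl hx
  · exact abs_sol_sub_sol_le μ a b hp2.le hk hx

end Continuity

/-! ### Lipschitz dependence on the distribution function -/

section Stability

variable (μ : Measure ℝ) [IsProbabilityMeasure μ] [NullSingletonClass μ]
  (ν : Measure ℝ) [IsProbabilityMeasure ν] [NullSingletonClass ν] (a b : ℝ) {l k R ε : ℝ}

/-- In the resolvent identity the difference of the two Volterra operators acts on the solution for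
`μ`, which is `C¹`, so `abs_integral_sub_integral_le` applies to it. -/
theorem abs_sol_sub_sol_measure_le
    (hε : ∀ t ∈ Icc (0 : ℝ) 1, |(∫ _ in (0 : ℝ)..t, (1 : ℝ) ∂μ) - ∫ _ in (0 : ℝ)..t, (1 : ℝ) ∂ν| ≤ ε)
    (hl : |l| ≤ R) {x : ℝ} (hx : x ∈ Icc (0 : ℝ) 1) :
    |sol ν a b l x - sol μ a b l x| ≤
      Real.exp R * (R * (solBound a b R + dsolBound a b R)) * ε := by
  have hR : 0 ≤ R := (abs_nonneg _).trans hl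
  have hε0 : 0 ≤ ε := (abs_nonneg _).trans (hε x hx)
  have hB := solBound_nonneg a b R
  have hD := dsolBound_nonneg a b hR
  set u := volterraInv μ l (affine a b) with hu
  have hbr : ‖l • volterra μ u - l • volterra ν u‖ ≤
      R * (solBound a b R + dsolBound a b R) * ε := by
    rw [ContinuousMap.norm_le _ (by positivity)]
    intro y
    have hp : ∀ z ∈ Icc (0 : ℝ) 1,
        |(∫ t in (0 : ℝ)..z, solExt μ a b l t ∂μ) - ∫ t in (0 : ℝ)..z, solExt μ a b l t ∂ν| ≤
          (solBound a b R + dsolBound a b R) * ε := by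
      intro z hz
      rw [integral_congr_of_mem_Icc (fun y hy => solExt_eq_sol μ a b hy) hz μ,
        integral_congr_of_mem_Icc (fun y hy => solExt_eq_sol μ a b hy) hz ν]
      exact abs_integral_sub_integral_le μ ν hε hD (hasDerivAt_sol μ a b l)
        (continuous_dsol μ a b l) (fun x hx => abs_sol_le μ a b hl hx)
        (fun x hx => abs_dsol_le μ a b hl hx) hz
    have e : (l • volterra μ u - l • volterra ν u) y =
        l * ∫ z in (0 : ℝ)..y, ((∫ t in (0 : ℝ)..z, solExt μ a b l t ∂μ) -
          ∫ t in (0 : ℝ)..z, solExt μ a b l t ∂ν) := by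
      rw [intervalIntegral.integral_sub
        ((continuous_integral_measure μ (solExt μ a b l).continuous).intervalIntegrable _ _)
        ((continuous_integral_measure ν (solExt μ a b l).continuous).intervalIntegrable _ _), mul_sub]
      rfl
    rw [e, norm_mul, Real.norm_eq_abs, mul_assoc]
    gcongr
    have := intervalIntegral.norm_integral_le_of_norm_le_const (a := (0 : ℝ)) (b := y)
      (C := (solBound a b R + dsolBound a b R) * ε)
      (f := fun z => (∫ t in (0 : ℝ)..z, solExt μ a b l t ∂μ) -
          ∫ t in (0 : ℝ)..z, solExt μ a b l t ∂ν) (by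
        intro z hz
        rw [uIoc_of_le y.2.1] at hz
        exact hp z ⟨hz.1.le, hz.2.trans y.2.2⟩)
    rw [sub_zero, abs_of_nonneg y.2.1] at this
    exact this.trans (mul_le_of_le_one_right (by positivity) y.2.2)
  rw [sol_eq_volterraInv ν a b hx, sol_eq_volterraInv μ a b hx]
  refine (ContinuousMap.norm_coe_le_norm
    (volterraInv ν l (affine a b) - volterraInv μ l (affine a b)) ⟨x, hx⟩).trans ?_
  rw [volterraInv_sub_apply μ ν]
  calc ‖volterraInv ν l (l • volterra μ u - l • volterra ν u)‖
      ≤ ‖volterraInv ν l‖ * ‖l • volterra μ u - l • volterra ν u‖ :=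
        ContinuousLinearMap.le_opNorm _ _
    _ ≤ Real.exp R * (R * (solBound a b R + dsolBound a b R) * ε) := by
        gcongr
        exact (norm_volterraInv_le ν l).trans (Real.exp_le_exp.2 hl)
    _ = _ := by ring

theorem abs_dsol_sub_dsol_measure_le
    (hε : ∀ t ∈ Icc (0 : ℝ) 1, |(∫ _ in (0 : ℝ)..t, (1 : ℝ) ∂μ) - ∫ _ in (0 : ℝ)..t, (1 : ℝ) ∂ν| ≤ ε)
    (hl : |l| ≤ R) {x : ℝ} (hx : x ∈ Icc (0 : ℝ) 1) :
    |dsol ν a b l x - dsol μ a b l x| ≤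
      R * (Real.exp R * (R * (solBound a b R + dsolBound a b R)) +
        (solBound a b R + dsolBound a b R)) * ε := by
  have hR : 0 ≤ R := (abs_nonneg _).trans hl
  have hε0 : 0 ≤ ε := (abs_nonneg _).trans (hε x hx)
  have hB := solBound_nonneg a b R
  have hD := dsolBound_nonneg a b hR
  have e : dsol ν a b l x - dsol μ a b l x =
      l * (((∫ t in (0 : ℝ)..x, sol μ a b l t ∂μ) - ∫ t in (0 : ℝ)..x, sol μ a b l t ∂ν) -
        ∫ t in (0 : ℝ)..x, (sol ν a b l t - sol μ a b l t) ∂ν) := by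
    rw [dsol_eq ν a b hx, dsol_eq μ a b hx, intervalIntegral.integral_sub
      ((continuous_sol ν a b l).intervalIntegrable _ _)
      ((continuous_sol μ a b l).intervalIntegrable _ _)]
    ring
  have h1 := abs_integral_sub_integral_le μ ν hε hD (hasDerivAt_sol μ a b l)
        (continuous_dsol μ a b l) (fun x hx => abs_sol_le μ a b hl hx)
        (fun x hx => abs_dsol_le μ a b hl hx) hx
  have h2 : |∫ t in (0 : ℝ)..x, (sol ν a b l t - sol μ a b l t) ∂ν| ≤
      Real.exp R * (R * (solBound a b R + dsolBound a b R)) * ε :=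
    abs_integral_measure_le ν (by positivity) hx.1 fun y hy =>
      abs_sol_sub_sol_measure_le μ ν a b hε hl ⟨hy.1, hy.2.trans hx.2⟩
  rw [e, abs_mul, mul_assoc R]
  gcongr
  refine (abs_sub _ _).trans ?_
  linarith

theorem abs_solInner_sub_solInner_le
    (hε : ∀ t ∈ Icc (0 : ℝ) 1, |(∫ _ in (0 : ℝ)..t, (1 : ℝ) ∂μ) - ∫ _ in (0 : ℝ)..t, (1 : ℝ) ∂ν| ≤ ε)
    (hl : |l| ≤ R) (hk : |k| ≤ R) :
    |solInner ν a b l k - solInner μ a b l k| ≤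
      (2 * solBound a b R * (Real.exp R * (R * (solBound a b R + dsolBound a b R))) +
        (solBound a b R * solBound a b R + 2 * solBound a b R * dsolBound a b R)) * ε := by
  have h1I : (1 : ℝ) ∈ Icc (0 : ℝ) 1 := right_mem_Icc.2 zero_le_one
  have hR : 0 ≤ R := (abs_nonneg _).trans hl
  have hε0 : 0 ≤ ε := (abs_nonneg _).trans (hε 1 h1I)
  have hB := solBound_nonneg a b R
  have hD := dsolBound_nonneg a b hR
  have hsμ : Continuous fun x => sol μ a b l x * sol μ a b k x :=
    (continuous_sol μ a b l).mul (continuous_sol μ a b k)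
  have hsν : Continuous fun x => sol ν a b l x * sol ν a b k x :=
    (continuous_sol ν a b l).mul (continuous_sol ν a b k)
  have e : solInner ν a b l k - solInner μ a b l k =
      (∫ t in (0 : ℝ)..1, (sol ν a b l t * sol ν a b k t - sol μ a b l t * sol μ a b k t) ∂ν) -
      ((∫ t in (0 : ℝ)..1, sol μ a b l t * sol μ a b k t ∂μ) -
        ∫ t in (0 : ℝ)..1, sol μ a b l t * sol μ a b k t ∂ν) := by
    rw [intervalIntegral.integral_sub (hsν.intervalIntegrable _ _) (hsμ.intervalIntegrable _ _),
      solInner, solInner]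
    ring
  have h1 : |∫ t in (0 : ℝ)..1,
      (sol ν a b l t * sol ν a b k t - sol μ a b l t * sol μ a b k t) ∂ν| ≤
      2 * solBound a b R * (Real.exp R * (R * (solBound a b R + dsolBound a b R))) * ε := by
    refine abs_integral_measure_le ν (by positivity) zero_le_one fun x hx => ?_
    have e : sol ν a b l x * sol ν a b k x - sol μ a b l x * sol μ a b k x =
        (sol ν a b l x - sol μ a b l x) * sol ν a b k x +
          sol μ a b l x * (sol ν a b k x - sol μ a b k x) := by ring
    rw [e]
    refine (abs_add_le _ _).trans ?_
    rw [abs_mul, abs_mul]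
    calc _ ≤ (Real.exp R * (R * (solBound a b R + dsolBound a b R)) * ε) * solBound a b R +
          solBound a b R * (Real.exp R * (R * (solBound a b R + dsolBound a b R)) * ε) := by
          gcongr
          · exact abs_sol_sub_sol_measure_le μ ν a b hε hl hx
          · exact abs_sol_le ν a b hk hx
          · exact abs_sol_le μ a b hl hx
          · exact abs_sol_sub_sol_measure_le μ ν a b hε hk hx
      _ = _ := by ring
  have h2 := abs_integral_sub_integral_le μ ν hε
    (v := fun x => sol μ a b l x * sol μ a b k x)
    (v' := fun x => dsol μ a b l x * sol μ a b k x + sol μ a b l x * dsol μ a b k x)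
    (A := solBound a b R * solBound a b R) (A' := 2 * solBound a b R * dsolBound a b R)
    (by positivity) (fun x => (hasDerivAt_sol μ a b l x).mul (hasDerivAt_sol μ a b k x))
    (((continuous_dsol μ a b l).mul (continuous_sol μ a b k)).add
      ((continuous_sol μ a b l).mul (continuous_dsol μ a b k)))
    (fun x hx => by
      rw [abs_mul]
      gcongr
      · exact abs_sol_le μ a b hl hx
      · exact abs_sol_le μ a b hk hx)
    (fun x hx => by
      refine (abs_add_le _ _).trans ?_
      rw [abs_mul, abs_mul]
      calc _ ≤ dsolBound a b R * solBound a b R + solBound a b R * dsolBound a b R := by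
            gcongr
            · exact abs_dsol_le μ a b hl hx
            · exact abs_sol_le μ a b hk hx
            · exact abs_sol_le μ a b hl hx
            · exact abs_dsol_le μ a b hk hx
        _ = _ := by ring) h1I
  rw [e]
  refine (abs_sub _ _).trans ?_
  linarith

end Stability

/-! ### The distance of distribution functions -/

theorem integral_one_eq_cdf {μ : Measure ℝ} (hμ : IsNonatomicProb μ) {t : ℝ}
    (ht : t ∈ Icc (0 : ℝ) 1) : ∫ _ in (0 : ℝ)..t, (1 : ℝ) ∂μ = cdf μ t := by
  have := hμ.isProbabilityMeasure
  have := hμ.nullSingleton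
  rw [intervalIntegral.integral_of_le ht.1, cdf_eq_real]
  simp only [integral_const, smul_eq_mul, mul_one, measureReal_restrict_apply_univ]
  have h0 : μ (Iic 0) = 0 := by
    rw [← Iio_union_right]
    refine measure_union_null (measure_mono_null ?_ hμ.compl_Icc) (measure_singleton _)
    exact fun x hx h => absurd h.1 (not_le.2 hx)
  rw [measureReal_def, measureReal_def, ← Iic_union_Ioc_eq_Iic ht.1,
    measure_union (Iic_disjoint_Ioc le_rfl) measurableSet_Ioc, h0, zero_add]

theorem abs_cdf_sub_cdf_le_cdfDist (μ ν : Measure ℝ) {t : ℝ} (ht : t ∈ Icc (0 : ℝ) 1) :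
    |cdf μ t - cdf ν t| ≤ cdfDist μ ν := by
  refine le_ciSup (f := fun x : Icc (0 : ℝ) 1 => |cdf μ x - cdf ν x|) ⟨1, ?_⟩ ⟨t, ht⟩
  rintro _ ⟨x, rfl⟩
  have h1 := cdf_nonneg μ x
  have h2 := cdf_le_one μ x
  have h3 := cdf_nonneg ν x
  have h4 := cdf_le_one ν x
  exact abs_sub_le_iff.2 ⟨by linarith, by linarith⟩

theorem abs_integral_one_sub_le_cdfDist {μ ν : Measure ℝ} (hμ : IsNonatomicProb μ)
    (hν : IsNonatomicProb ν) : ∀ t ∈ Icc (0 : ℝ) 1,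
    |(∫ _ in (0 : ℝ)..t, (1 : ℝ) ∂μ) - ∫ _ in (0 : ℝ)..t, (1 : ℝ) ∂ν| ≤ cdfDist μ ν :=
  fun t ht => by
    rw [integral_one_eq_cdf hμ ht, integral_one_eq_cdf hν ht]
    exact abs_cdf_sub_cdf_le_cdfDist μ ν ht

theorem cdfDist_nonneg (μ ν : Measure ℝ) : 0 ≤ cdfDist μ ν :=
  (abs_nonneg _).trans (abs_cdf_sub_cdf_le_cdfDist μ ν (left_mem_Icc.2 zero_le_one))

theorem tendsto_cdfDist {μ : Measure ℝ} {ν : ℕ → Measure ℝ}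
    (h : TendstoUniformlyOn (fun n x => cdf (ν n) x) (fun x => cdf μ x) atTop (Icc (0 : ℝ) 1)) :
    Tendsto (fun n => cdfDist μ (ν n)) atTop (𝓝 0) := by
  rw [Metric.tendstoUniformlyOn_iff] at h
  rw [Metric.tendsto_nhds]
  intro ε hε
  filter_upwards [h (ε / 2) (half_pos hε)] with n hn
  rw [Real.dist_eq, sub_zero, abs_of_nonneg (cdfDist_nonneg _ _)]
  have : Nonempty (Icc (0 : ℝ) 1) := ⟨⟨0, left_mem_Icc.2 zero_le_one⟩⟩
  refine (ciSup_le fun x : Icc (0 : ℝ) 1 => ?_).trans_lt (half_lt_self hε)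
  exact (hn x x.2).le

/-! ### Enumeration of a discrete set that is bounded below -/

section NthLeast

variable {S : Set ℝ}

/-- A smaller `s ∈ S` has strictly fewer elements below it, since `s` itself drops out and the sets
are finite. Counting therefore identifies the `k`-th element. -/
theorem nthLeast_eq {x : ℝ} {k : ℕ} (hx : x ∈ S) (h : (S ∩ Iio x).encard = k) :
    nthLeast S k = x := by
  refine IsLeast.csInf_eq ⟨⟨hx, h.ge⟩, ?_⟩
  rintro s ⟨hs, hk⟩
  by_contra! hsx
  have hlt : (S ∩ Iio s).encard < (S ∩ Iio x).encard := by
    refine Set.Finite.encard_lt_encard ?_ ⟨fun y hy => ⟨hy.1, lt_trans hy.2 hsx⟩, fun hsub => ?_⟩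
    · exact (finite_of_encard_eq_coe h).subset fun y hy => ⟨hy.1, lt_trans hy.2 hsx⟩
    · exact lt_irrefl s (hsub ⟨hs, hsx⟩).2
  rw [h] at hlt
  exact absurd hk (not_le.2 hlt)

variable (hfin : ∀ R, (S ∩ Iic R).Finite) (hinf : S.Infinite)
include hfin hinf

theorem exists_mem_encard_eq (k : ℕ) : ∃ x ∈ S, (S ∩ Iio x).encard = k := by
  induction k with
  | zero =>
    obtain ⟨y, hy⟩ := hinf.nonempty
    obtain ⟨x, hx, hmin⟩ := (S ∩ Iic y).exists_min_image id (hfin y) ⟨y, hy, mem_Iic.2 le_rfl⟩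
    refine ⟨x, hx.1, ?_⟩
    rw [Nat.cast_zero, encard_eq_zero, eq_empty_iff_forall_notMem]
    rintro z ⟨hz, hzx⟩
    exact absurd (hmin z ⟨hz, mem_Iic.2 ((le_of_lt hzx).trans hx.2)⟩) (not_le.2 hzx)
  | succ k ih =>
    obtain ⟨w, hw, hk⟩ := ih
    obtain ⟨y, hyS, hy⟩ := (hinf.sdiff (hfin w)).nonempty
    have hwy : w < y := by
      by_contra! h
      exact hy ⟨hyS, h⟩
    obtain ⟨x, hx, hmin⟩ := (S ∩ Ioc w y).exists_min_image id
      ((hfin y).subset fun z hz => ⟨hz.1, hz.2.2⟩) ⟨y, hyS, hwy, le_rfl⟩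
    refine ⟨x, hx.1, ?_⟩
    have : S ∩ Iio x = insert w (S ∩ Iio w) := by
      ext z
      simp only [mem_inter_iff, mem_Iio, mem_insert_iff]
      constructor
      · rintro ⟨hz, hzx⟩
        rcases lt_trichotomy z w with h | h | h
        · exact Or.inr ⟨hz, h⟩
        · exact Or.inl h
        · exact absurd (hmin z ⟨hz, h, hzx.le.trans hx.2.2⟩) (not_le.2 hzx)
      · rintro (rfl | ⟨hz, hzw⟩)
        · exact ⟨hw, hx.2.1⟩
        · exact ⟨hz, hzw.trans hx.2.1⟩
    rw [this, encard_insert_of_notMem (fun h => lt_irrefl w h.2), hk]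
    norm_cast

theorem nthLeast_mem_and_encard_eq (k : ℕ) :
    nthLeast S k ∈ S ∧ (S ∩ Iio (nthLeast S k)).encard = k := by
  obtain ⟨x, hx, hk⟩ := exists_mem_encard_eq hfin hinf k
  rw [nthLeast_eq hx hk]
  exact ⟨hx, hk⟩

theorem strictMono_nthLeast : StrictMono (nthLeast S) := by
  intro j k hjk
  by_contra! h
  have h1 := (nthLeast_mem_and_encard_eq hfin hinf j).2
  have h2 := (nthLeast_mem_and_encard_eq hfin hinf k).2
  have : (S ∩ Iio (nthLeast S k)).encard ≤ (S ∩ Iio (nthLeast S j)).encard :=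
    encard_le_encard fun y hy => ⟨hy.1, lt_of_lt_of_le hy.2 h⟩
  rw [h1, h2] at this
  exact absurd (Nat.cast_le.1 this) (not_le.2 hjk)

theorem range_nthLeast : range (nthLeast S) = S := by
  refine Subset.antisymm ?_ fun x hx => ?_
  · rintro _ ⟨k, rfl⟩
    exact (nthLeast_mem_and_encard_eq hfin hinf k).1
  · have hf : (S ∩ Iio x).Finite := (hfin x).subset fun y hy => ⟨hy.1, mem_Iic.2 (le_of_lt hy.2)⟩
    obtain ⟨k, hk⟩ := ENat.ne_top_iff_exists.1 (encard_ne_top_iff.2 hf)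
    exact ⟨k, nthLeast_eq hx hk.symm⟩

end NthLeast

/-! ### Zeros of characteristic functions -/

/-- `B` is a real characteristic function: its zeros are nonnegative, and at each zero `k` it
factors, up to a constant, as `l - k` times a kernel `I l k` that is positive on the diagonal. -/
structure IsCharacteristic (B : ℝ → ℝ) (I : ℝ → ℝ → ℝ) : Prop where
  continuous : Continuous B
  continuous_kernel : Continuous fun p : ℝ × ℝ => I p.1 p.2
  kernel_self_pos : ∀ k, 0 < I k k
  exists_mul_eq : ∀ k, B k = 0 → ∃ r, ∀ l, r * B l = (l - k) * I l k
  nonneg_of_eq_zero : ∀ k, B k = 0 → 0 ≤ k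

namespace IsCharacteristic

variable {B : ℝ → ℝ} {I : ℝ → ℝ → ℝ} (h : IsCharacteristic B I)
include h

/-- Orthogonality of eigenfunctions for distinct eigenvalues, in abstract form. -/
theorem kernel_eq_zero {l k : ℝ} (hl : B l = 0) (hk : B k = 0) (hlk : l ≠ k) : I l k = 0 := by
  obtain ⟨r, hr⟩ := h.exists_mul_eq k hk
  have := hr l
  rw [hl, mul_zero, eq_comm, mul_eq_zero, sub_eq_zero] at this
  exact this.resolve_left hlk

theorem exists_kernel_lower_bound (k : ℝ) : ∃ c > 0, ∃ ρ > 0,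
    ∀ x ∈ Icc (k - ρ) (k + ρ), ∀ y ∈ Icc (k - ρ) (k + ρ), c ≤ I x y := by
  have hk := h.kernel_self_pos k
  have h1 : ∀ᶠ p : ℝ × ℝ in 𝓝 (k, k), I k k / 2 < I p.1 p.2 :=
    h.continuous_kernel.continuousAt.eventually_const_lt (half_lt_self hk)
  obtain ⟨ρ, hρ, hball⟩ := Metric.eventually_nhds_iff_ball.1 h1
  refine ⟨I k k / 2, half_pos hk, ρ / 2, half_pos hρ, fun x hx y hy => (hball (x, y) ?_).le⟩
  rw [Metric.mem_ball, Prod.dist_eq, Real.dist_eq, Real.dist_eq]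
  refine max_lt (abs_lt.2 ⟨?_, ?_⟩) (abs_lt.2 ⟨?_, ?_⟩) <;>
    linarith [hx.1, hx.2, hy.1, hy.2]

/-- A second zero close to `k` would be orthogonal to it, but the kernel is positive near the
diagonal. -/
theorem exists_isolated {k : ℝ} (hk : B k = 0) :
    ∃ ρ > 0, ∀ x ∈ Icc (k - ρ) (k + ρ), B x = 0 → x = k := by
  obtain ⟨c, hc, ρ, hρ, hI⟩ := h.exists_kernel_lower_bound k
  refine ⟨ρ, hρ, fun x hx hBx => ?_⟩
  by_contra hne
  have h1 := hI x hx k ⟨by linarith, by linarith⟩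
  rw [h.kernel_eq_zero hBx hk hne] at h1
  exact absurd h1 (not_le.2 hc)

theorem finite_zeros_inter_Iic (R : ℝ) : ({l | B l = 0} ∩ Iic R).Finite := by
  by_contra hinf
  have hsub : {l | B l = 0} ∩ Iic R ⊆ Icc 0 R := fun x hx =>
    ⟨h.nonneg_of_eq_zero x hx.1, hx.2⟩
  obtain ⟨k, -, hacc⟩ := Set.Infinite.exists_accPt_of_subset_isCompact hinf isCompact_Icc hsub
  have hclosed : IsClosed ({l | B l = 0} ∩ Iic R) :=
    (isClosed_eq h.continuous continuous_const).inter isClosed_Iic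
  have hk : B k = 0 := by
    have := mem_closure_iff_clusterPt.2 hacc.clusterPt
    rw [hclosed.closure_eq] at this
    exact this.1
  obtain ⟨ρ, hρ, hiso⟩ := h.exists_isolated hk
  rw [accPt_iff_nhds] at hacc
  obtain ⟨y, ⟨hy1, hy2⟩, hne⟩ := hacc _ (Icc_mem_nhds (sub_lt_self k hρ) (lt_add_of_pos_right k hρ))
  exact hne (hiso y hy1 hy2.1)

end IsCharacteristic

/-! ### Perturbation of the zeros and stability of their indices -/

section Perturbation

variable {B : ℝ → ℝ} {I : ℝ → ℝ → ℝ} {ι : Type*} {L : Filter ι} {B' : ι → ℝ → ℝ}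
  {I' : ι → ℝ → ℝ → ℝ} {ε : ι → ℝ}

theorem eventually_mul_lt (hε : Tendsto ε L (𝓝 0)) (K : ℝ) {η : ℝ} (hη : 0 < η) :
    ∀ᶠ i in L, K * ε i < η := by
  have : Tendsto (fun i => K * ε i) L (𝓝 0) := by simpa using hε.const_mul K
  exact this.eventually_lt_const hη

theorem eventually_ne_zero (h : IsCharacteristic B I) (hε : Tendsto ε L (𝓝 0))
    (hB : ∀ R, ∃ K, ∀ᶠ i in L, ∀ l, |l| ≤ R → |B' i l - B l| ≤ K * ε i) {p q : ℝ}
    (hpq : ∀ l ∈ Icc p q, B l ≠ 0) : ∀ᶠ i in L, ∀ l ∈ Icc p q, B' i l ≠ 0 := by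
  rcases (Icc p q).eq_empty_or_nonempty with hem | hne
  · simp [hem]
  obtain ⟨m, hm, hmin⟩ := isCompact_Icc.exists_isMinOn hne h.continuous.abs.continuousOn
  obtain ⟨K, hK⟩ := hB (max |p| |q|)
  filter_upwards [hK, eventually_mul_lt hε K (abs_pos.2 (hpq m hm))] with i hi hlt l hl h0
  have h1 := hi l (abs_le_max_abs_abs hl.1 hl.2)
  rw [h0, zero_sub, abs_neg] at h1
  have h2 : |B m| ≤ |B l| := hmin hl
  linarith

theorem tendsto_of_abs_sub_le (hε : Tendsto ε L (𝓝 0))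
    (hB : ∀ R, ∃ K, ∀ᶠ i in L, ∀ l, |l| ≤ R → |B' i l - B l| ≤ K * ε i) (l : ℝ) :
    Tendsto (fun i => B' i l) L (𝓝 (B l)) := by
  obtain ⟨K, hK⟩ := hB |l|
  rw [tendsto_iff_dist_tendsto_zero]
  refine squeeze_zero' (Eventually.of_forall fun _ => dist_nonneg)
    (hK.mono fun i hi => hi l le_rfl) ?_
  simpa using hε.const_mul K

/-- The constant is fixed before `ρ`, so the window can later be shrunk to avoid other zeros without
affecting the rate. -/
theorem exists_zero_near (h : IsCharacteristic B I) (h' : ∀ᶠ i in L, IsCharacteristic (B' i) (I' i))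
    (hε0 : ∀ i, 0 ≤ ε i) (hε : Tendsto ε L (𝓝 0))
    (hB : ∀ R, ∃ K, ∀ᶠ i in L, ∀ l, |l| ≤ R → |B' i l - B l| ≤ K * ε i)
    (hI : ∀ R, ∃ K, ∀ᶠ i in L, ∀ l k, |l| ≤ R → |k| ≤ R → |I' i l k - I l k| ≤ K * ε i)
    {k : ℝ} (hk : B k = 0) :
    ∃ c > 0, ∃ ρ₀ > 0, ∀ ρ, 0 < ρ → ρ ≤ ρ₀ → ∀ᶠ i in L, ∃ x ∈ Icc (k - ρ) (k + ρ),
      B' i x = 0 ∧ |k - x| ≤ c * ε i ∧ ∀ y ∈ Icc (k - ρ) (k + ρ), B' i y = 0 → y = x := by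
  obtain ⟨c, hc, ρ₀, hρ₀, hIc⟩ := h.exists_kernel_lower_bound k
  obtain ⟨r, hr⟩ := h.exists_mul_eq k hk
  obtain ⟨K, hK⟩ := hB (|k| + ρ₀)
  obtain ⟨K', hK'⟩ := hI (|k| + ρ₀)
  -- `c` bounds the kernel from below, `r` is the factor at `k` and `K` the error constant of `B`;
  -- the summand `1` only ensures positivity.
  refine ⟨|r| * |K| / c + 1, by positivity, ρ₀, hρ₀, fun ρ hρ hρρ => ?_⟩
  have hsub : Icc (k - ρ) (k + ρ) ⊆ Icc (k - ρ₀) (k + ρ₀) :=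
    Icc_subset_Icc (by linarith) (by linarith)
  have hkk : k ∈ Icc (k - ρ₀) (k + ρ₀) := ⟨by linarith, by linarith⟩
  have hR : ∀ x ∈ Icc (k - ρ) (k + ρ), |x| ≤ |k| + ρ₀ := fun x hx => by
    have := hsub hx
    exact abs_le.2 ⟨by linarith [neg_abs_le k, this.1], by linarith [le_abs_self k, this.2]⟩
  -- `r * B` changes sign across `k`, and this survives small perturbations.
  have hright : 0 < r * B (k + ρ) := by
    rw [hr, add_sub_cancel_left]
    exact mul_pos hρ (hc.trans_le (hIc _ (hsub ⟨by linarith, le_rfl⟩) k hkk))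
  have hleft : r * B (k - ρ) < 0 := by
    rw [hr, sub_sub_cancel_left]
    exact mul_neg_of_neg_of_pos (neg_neg_of_pos hρ)
      (hc.trans_le (hIc _ (hsub ⟨le_rfl, by linarith⟩) k hkk))
  have hr0 : r ≠ 0 := by
    rintro rfl
    simp at hright
  filter_upwards [h', hK, hK', eventually_mul_lt hε K' hc,
    ((tendsto_of_abs_sub_le hε hB (k + ρ)).const_mul r).eventually_const_lt hright,
    ((tendsto_of_abs_sub_le hε hB (k - ρ)).const_mul r).eventually_lt_const hleft]
    with i hi hBi hIi hlt hri hle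
  have hcont : ContinuousOn (fun l => r * B' i l) (Icc (k - ρ) (k + ρ)) :=
    (continuous_const.mul hi.continuous).continuousOn
  obtain ⟨x, hx, hx0⟩ := intermediate_value_Icc (by linarith : k - ρ ≤ k + ρ) hcont
    (show (0 : ℝ) ∈ Icc (r * B' i (k - ρ)) (r * B' i (k + ρ)) from ⟨hle.le, hri.le⟩)
  have hBx : B' i x = 0 := (mul_eq_zero.1 hx0).resolve_left hr0
  refine ⟨x, hx, hBx, ?_, fun y hy hBy => ?_⟩
  -- The factorization of the unperturbed `B` is evaluated at the perturbed zero `x`, where `B x` is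
  -- minus the error.
  · have h1 : c * |k - x| ≤ |r| * |K| * ε i := by
      calc c * |k - x| ≤ I x k * |x - k| := by
            rw [abs_sub_comm]
            gcongr
            exact hIc x (hsub hx) k hkk
        _ = |r * B x| := by
            rw [hr, abs_mul, abs_of_pos (hc.trans_le (hIc x (hsub hx) k hkk)), mul_comm]
        _ = |r| * |B' i x - B x| := by rw [hBx, zero_sub, abs_neg, abs_mul]
        _ ≤ |r| * (|K| * ε i) := by
            gcongr
            refine (hBi x (hR x hx)).trans ?_
            gcongr
            · exact hε0 i
            · exact le_abs_self K
        _ = _ := by ring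
    have h2 : |k - x| ≤ |r| * |K| / c * ε i := by
      rw [div_mul_eq_mul_div, le_div_iff₀ hc]
      linarith
    linarith [hε0 i]
  -- Two perturbed zeros in the window would make `I' i y x` vanish, though it is within `c` of `I y
  -- x ≥ c`.
  · by_contra hne
    have h1 := hIi y x (hR y hy) (hR x hx)
    rw [hi.kernel_eq_zero hBy hBx hne, zero_sub, abs_neg] at h1
    linarith [le_abs_self (I y x), hIc y (hsub hy) x (hsub hx)]

theorem inter_Iio_eq_insert {Z : Set ℝ} {s t x : ℝ} (hst : s ≤ x) (hxt : x < t) (hx : x ∈ Z)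
    (huniq : ∀ y ∈ Z, s ≤ y → y < t → y = x) : Z ∩ Iio t = insert x (Z ∩ Iio s) := by
  ext y
  simp only [mem_inter_iff, mem_Iio, mem_insert_iff]
  constructor
  · rintro ⟨hy, hyt⟩
    rcases lt_or_ge y s with hys | hys
    · exact Or.inr ⟨hy, hys⟩
    · exact Or.inl (huniq y hy hys hyt)
  · rintro (rfl | ⟨hy, hys⟩)
    · exact ⟨hx, hxt⟩
    · exact ⟨hy, hys.trans (hst.trans_lt hxt)⟩

variable (h : IsCharacteristic B I) (h' : ∀ᶠ i in L, IsCharacteristic (B' i) (I' i))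
    (hε0 : ∀ i, 0 ≤ ε i) (hε : Tendsto ε L (𝓝 0))
    (hB : ∀ R, ∃ K, ∀ᶠ i in L, ∀ l, |l| ≤ R → |B' i l - B l| ≤ K * ε i)
    (hI : ∀ R, ∃ K, ∀ᶠ i in L, ∀ l k, |l| ≤ R → |k| ≤ R → |I' i l k - I l k| ≤ K * ε i)
include h h' hε0 hε hB hI

/-- Induction by removing the largest zero `k` below `t`: the window around `k` contributes exactly
one perturbed zero, the rest of the interval up to `t` none. In the base case the common lower bound
`0` of all zeros is essential: it leaves a compact interval to control. -/
theorem eventually_encard_zeros_eq (m : ℕ) : ∀ t, B t ≠ 0 →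
    ({l | B l = 0} ∩ Iio t).encard = m → ∀ᶠ i in L, ({l | B' i l = 0} ∩ Iio t).encard = m := by
  induction m with
  | zero =>
    intro t ht hcard
    rw [Nat.cast_zero, encard_eq_zero] at hcard
    have hno : ∀ l ∈ Icc 0 t, B l ≠ 0 := by
      intro l hl h0
      rcases hl.2.lt_or_eq with hlt | rfl
      · exact (hcard ▸ (⟨h0, hlt⟩ : l ∈ {l | B l = 0} ∩ Iio t) : l ∈ (∅ : Set ℝ))
      · exact ht h0
    filter_upwards [h', eventually_ne_zero h hε hB hno] with i hi hne
    rw [Nat.cast_zero, encard_eq_zero, eq_empty_iff_forall_notMem]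
    rintro l ⟨h0, hlt⟩
    exact hne l ⟨hi.nonneg_of_eq_zero l h0, le_of_lt hlt⟩ h0
  | succ m ih =>
    intro t ht hcard
    have hfin : ({l | B l = 0} ∩ Iio t).Finite := finite_of_encard_eq_coe hcard
    have hnon : ({l | B l = 0} ∩ Iio t).Nonempty := by
      rw [← encard_ne_zero, hcard]
      exact_mod_cast Nat.succ_ne_zero m
    obtain ⟨k, ⟨hk, hkt⟩, hmax⟩ := exists_max_image _ id hfin hnon
    rw [mem_Iio] at hkt
    obtain ⟨c, -, ρ₁, hρ₁, hnear⟩ := exists_zero_near h h' hε0 hε hB hI hk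
    obtain ⟨ρ₂, hρ₂, hiso⟩ := h.exists_isolated hk
    obtain ⟨ρ, hρ, hρ1, hρ2, hρt⟩ : ∃ ρ > 0, ρ ≤ ρ₁ ∧ ρ ≤ ρ₂ ∧ k + ρ < t := by
      refine ⟨min (min ρ₁ ρ₂) ((t - k) / 2), ?_, ?_, ?_, ?_⟩
      · have : 0 < t - k := by linarith
        positivity
      · exact (min_le_left _ _).trans (min_le_left _ _)
      · exact (min_le_left _ _).trans (min_le_right _ _)
      · linarith [min_le_right (min ρ₁ ρ₂) ((t - k) / 2)]
    have hBs : B (k - ρ) ≠ 0 := fun h0 => by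
      have := hiso (k - ρ) ⟨by linarith, by linarith⟩ h0
      linarith
    have hcard' : ({l | B l = 0} ∩ Iio (k - ρ)).encard = m := by
      rw [inter_Iio_eq_insert (by linarith : k - ρ ≤ k) hkt hk fun y hy hys hyt =>
        hiso y ⟨by linarith, (hmax y ⟨hy, hyt⟩).trans (by simp only [id]; linarith)⟩ hy,
        encard_insert_of_notMem (fun hm => by linarith [mem_Iio.1 hm.2])] at hcard
      have : ((m + 1 : ℕ) : ℕ∞) = (m : ℕ∞) + 1 := by norm_cast
      rw [this] at hcard
      exact WithTop.add_right_cancel ENat.one_ne_top hcard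
    have hno : ∀ l ∈ Icc (k + ρ) t, B l ≠ 0 := by
      intro l hl h0
      rcases hl.2.lt_or_eq with hlt | rfl
      · have : l ≤ k := hmax l ⟨h0, hlt⟩
        linarith [hl.1]
      · exact ht h0
    filter_upwards [ih (k - ρ) hBs hcard', hnear ρ hρ hρ1, eventually_ne_zero h hε hB hno]
      with i h1 ⟨x, hx, hx0, _, huniq⟩ h3
    rw [inter_Iio_eq_insert (Z := {l | B' i l = 0}) (s := k - ρ) hx.1 (by linarith [hx.2]) hx0 fun y hy hys hyt =>
      huniq y ⟨hys, ?_⟩ hy, encard_insert_of_notMem (fun hm => by linarith [mem_Iio.1 hm.2, hx.1]),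
      h1]
    · norm_cast
    · by_contra! hlt
      exact h3 y ⟨hlt.le, hyt.le⟩ hy

theorem exists_abs_nthLeast_sub_le (hinf : {l | B l = 0}.Infinite) (m : ℕ) :
    ∃ c > 0, ∀ᶠ i in L,
      |nthLeast {l | B l = 0} m - nthLeast {l | B' i l = 0} m| ≤ c * ε i := by
  obtain ⟨hk, hcard⟩ := nthLeast_mem_and_encard_eq h.finite_zeros_inter_Iic hinf m
  set k := nthLeast {l | B l = 0} m
  obtain ⟨c, hc, ρ₁, hρ₁, hnear⟩ := exists_zero_near h h' hε0 hε hB hI hk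
  obtain ⟨ρ₂, hρ₂, hiso⟩ := h.exists_isolated hk
  refine ⟨c, hc, ?_⟩
  have hρ : 0 < min ρ₁ ρ₂ := lt_min hρ₁ hρ₂
  set ρ := min ρ₁ ρ₂
  have hρ2 : ρ ≤ ρ₂ := min_le_right _ _
  have hBs : B (k - ρ) ≠ 0 := fun h0 => by
    have := hiso (k - ρ) ⟨by linarith, by linarith⟩ h0
    linarith
  have hcard' : ({l | B l = 0} ∩ Iio (k - ρ)).encard = m := by
    rw [← hcard]
    congr 1
    ext y
    simp only [mem_inter_iff, mem_Iio, and_congr_right_iff]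
    refine fun hy => ⟨fun h => by linarith, fun hyk => ?_⟩
    by_contra! hge
    exact hyk.ne (hiso y ⟨by linarith, by linarith⟩ hy)
  -- There are `m` perturbed zeros below the window and a single one inside it, so that one has
  -- index `m`.
  filter_upwards [eventually_encard_zeros_eq h h' hε0 hε hB hI m (k - ρ) hBs hcard',
    hnear ρ hρ (min_le_left _ _)] with i h1 ⟨x, hx, hx0, hest, huniq⟩
  rw [nthLeast_eq (S := {l | B' i l = 0}) hx0]
  · exact hest
  · rw [← h1]
    congr 1
    ext y
    simp only [mem_inter_iff, mem_Iio, and_congr_right_iff]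
    refine fun hy => ⟨fun hyx => ?_, fun h => h.trans_le hx.1⟩
    by_contra! hge
    exact hyx.ne (huniq y ⟨hge, hyx.le.trans hx.2⟩ hy)

end Perturbation

/-! ### Eigenvalues as zeros of the shooting functions -/

section Spectrum

variable (μ : Measure ℝ) [IsProbabilityMeasure μ] [NullSingletonClass μ]

theorem sol_smul (c a b l : ℝ) {x : ℝ} (hx : x ∈ Icc (0 : ℝ) 1) :
    sol μ (c * a) (c * b) l x = c * sol μ a b l x := by
  have : affine (c * a) (c * b) = c • affine a b := by
    ext y
    change c * a + c * b * y = c * (a + b * y)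
    ring
  rw [sol_eq_volterraInv μ _ _ hx, sol_eq_volterraInv μ _ _ hx, this, map_smul]
  rfl

theorem dsol_smul (c a b l : ℝ) {x : ℝ} (hx : x ∈ Icc (0 : ℝ) 1) :
    dsol μ (c * a) (c * b) l x = c * dsol μ a b l x := by
  rw [dsol_eq μ _ _ hx, dsol_eq μ _ _ hx,
    integral_congr_of_mem_Icc (fun y hy => sol_smul μ c a b l hy) hx,
    intervalIntegral.integral_const_mul]
  ring

theorem derivWithin_sol (a b l : ℝ) {x : ℝ} (hx : x ∈ Icc (0 : ℝ) 1) :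
    derivWithin (sol μ a b l) (Icc 0 1) x = dsol μ a b l x :=
  (hasDerivAt_sol μ a b l x).hasDerivWithinAt.derivWithin (uniqueDiffOn_Icc_zero_one x hx)

variable {μ}

theorem isEigenfunction_sol (hμ : μ (Icc (0 : ℝ) 1)ᶜ = 0) {a b : ℝ} (hab : a ≠ 0 ∨ b ≠ 0) (l : ℝ) :
    IsEigenfunction μ l (sol μ a b l) := by
  have h0I : (0 : ℝ) ∈ Icc (0 : ℝ) 1 := left_mem_Icc.2 zero_le_one
  have h1I : (1 : ℝ) ∈ Icc (0 : ℝ) 1 := right_mem_Icc.2 zero_le_one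
  constructor
  · by_contra! h
    have hpos := solInner_self_pos hμ hab l
    rw [solInner, integral_congr_of_mem_Icc (g := fun _ => 0) (fun x hx => by simp [h x hx]) h1I]
      at hpos
    simp at hpos
  refine ⟨fun x => -l * solExt μ a b l x, ⟨?_, ?_, ?_⟩, ?_⟩
  · refine ContDiff.contDiffOn (contDiff_one_iff_deriv.2 ⟨fun x =>
      (hasDerivAt_sol μ a b l x).differentiableAt, ?_⟩)
    rw [funext fun x => (hasDerivAt_sol μ a b l x).deriv]
    exact continuous_dsol μ a b l
  · refine MemLp.of_bound (continuous_const.mul (solExt μ a b l).continuous).aestronglyMeasurable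
      (|l| * ‖volterraInv μ l (affine a b)‖) (Eventually.of_forall fun x => ?_)
    rw [norm_mul, norm_neg, Real.norm_eq_abs]
    gcongr
    exact ContinuousMap.norm_coe_le_norm (volterraInv μ l (affine a b)) (projIcc 0 1 zero_le_one x)
  · intro x hx
    rw [derivWithin_sol μ a b l hx, derivWithin_sol μ a b l h0I, dsol_zero,
      intervalIntegral.integral_const_mul, dsol]
    ring
  · filter_upwards [mem_ae_iff.2 hμ] with x hx
    rw [solExt_eq_sol μ a b hx]

/-- Integrating the equation twice gives the Volterra equation, whose solution is unique. -/
theorem eq_sol_of_graph {f g : ℝ → ℝ} {l : ℝ} (hG : Graph μ f g)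
    (hg : g =ᵐ[μ] fun x => -l * f x) {x : ℝ} (hx : x ∈ Icc (0 : ℝ) 1) :
    f x = sol μ (f 0) (derivWithin f (Icc 0 1) 0) l x ∧
      derivWithin f (Icc 0 1) x = dsol μ (f 0) (derivWithin f (Icc 0 1) 0) l x := by
  obtain ⟨hf, -, hd⟩ := hG
  have hfc : ContinuousOn f (Icc 0 1) := hf.continuousOn
  set F : C(Icc (0 : ℝ) 1, ℝ) := ⟨(Icc (0 : ℝ) 1).domRestrict f, hfc.domRestrict⟩
  have hF : ∀ y ∈ Icc (0 : ℝ) 1, f y = F.IccExtend zero_le_one y := fun y hy => by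
    rw [ContinuousMap.coe_IccExtend, IccExtend_of_mem _ _ hy]
    rfl
  set d := derivWithin f (Icc 0 1) with hd_def
  have hder : ∀ y ∈ Icc (0 : ℝ) 1, d y = d 0 - l * ∫ t in (0 : ℝ)..y, f t ∂μ := by
    intro y hy
    rw [hd y hy, intervalIntegral.integral_congr_ae (g := fun t => -l * f t)
      (hg.mono fun t ht _ => ht), intervalIntegral.integral_const_mul]
    ring
  have hint : ∀ y ∈ Icc (0 : ℝ) 1, f y = f 0 + d 0 * y - l * doublePrim μ f y := by
    intro y hy
    have hsub : Icc 0 y ⊆ Icc (0 : ℝ) 1 := Icc_subset_Icc_right hy.2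
    have hdc : ContinuousOn d (Icc 0 1) := hf.continuousOn_derivWithin uniqueDiffOn_Icc_zero_one le_rfl
    have hftc : ∫ t in (0 : ℝ)..y, d t = f y - f 0 := by
      refine intervalIntegral.integral_eq_sub_of_hasDerivAt_of_le hy.1 (hfc.mono hsub) ?_
        (ContinuousOn.intervalIntegrable (by rw [uIcc_of_le hy.1]; exact hdc.mono hsub))
      intro t ht
      have htI : t ∈ Icc (0 : ℝ) 1 := hsub (Ioo_subset_Icc_self ht)
      exact ((hf.differentiableOn one_ne_zero t htI).hasDerivWithinAt).hasDerivAt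
        (Icc_mem_nhds ht.1 (ht.2.trans_le hy.2))
    have hp : ∀ z ∈ Icc (0 : ℝ) 1, ∫ t in (0 : ℝ)..z, f t ∂μ =
        ∫ t in (0 : ℝ)..z, F.IccExtend zero_le_one t ∂μ :=
      fun z hz => integral_congr_of_mem_Icc hF hz μ
    have hdd : ∀ z ∈ Icc (0 : ℝ) 1, d z = d 0 - l * ∫ t in (0 : ℝ)..z, F.IccExtend zero_le_one t ∂μ :=
      fun z hz => by rw [hder z hz, hp z hz]
    have hcF := continuous_integral_measure μ (F.IccExtend zero_le_one).continuous
    rw [integral_congr_of_mem_Icc hdd hy, intervalIntegral.integral_sub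
      (continuous_const.intervalIntegrable _ _) ((hcF.const_mul l).intervalIntegrable _ _),
      intervalIntegral.integral_const_mul] at hftc
    rw [doublePrim, integral_congr_of_mem_Icc hp hy]
    simp only [intervalIntegral.integral_const, sub_zero, smul_eq_mul] at hftc
    linarith
  have hsol : ∀ y ∈ Icc (0 : ℝ) 1, f y = sol μ (f 0) (d 0) l y := fun y hy =>
    eq_sol_of_integral_eq μ (f 0) (d 0) hfc hint hy
  refine ⟨hsol x hx, ?_⟩
  rw [hder x hx, dsol_eq μ _ _ hx, integral_congr_of_mem_Icc hsol hx]

theorem neumannSpectrum_eq (hμ : μ (Icc (0 : ℝ) 1)ᶜ = 0) :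
    neumannSpectrum μ = {l | dsol μ 1 0 l 1 = 0} := by
  have h0I : (0 : ℝ) ∈ Icc (0 : ℝ) 1 := left_mem_Icc.2 zero_le_one
  have h1I : (1 : ℝ) ∈ Icc (0 : ℝ) 1 := right_mem_Icc.2 zero_le_one
  ext l
  constructor
  · rintro ⟨f, ⟨⟨x, hx, hfx⟩, g, hG, hg⟩, hf0, hf1⟩
    have h1 := (eq_sol_of_graph hG hg h1I).2
    have h2 := (eq_sol_of_graph hG hg hx).1
    have ha := sol_smul μ (f 0) 1 0 l hx
    have hb := dsol_smul μ (f 0) 1 0 l h1I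
    rw [mul_one, mul_zero] at ha hb
    rw [hf1, hf0, hb] at h1
    rw [hf0, ha] at h2
    refine (mul_eq_zero.1 h1.symm).resolve_left fun h => hfx ?_
    rw [h2, h, zero_mul]
  · intro hl
    refine ⟨sol μ 1 0 l, isEigenfunction_sol hμ (Or.inl one_ne_zero) l, ?_, ?_⟩
    · rw [derivWithin_sol μ 1 0 l h0I, dsol_zero]
    · rw [derivWithin_sol μ 1 0 l h1I]
      exact hl

theorem dirichletSpectrum_eq (hμ : μ (Icc (0 : ℝ) 1)ᶜ = 0) :
    dirichletSpectrum μ = {l | sol μ 0 1 l 1 = 0} := by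
  have h1I : (1 : ℝ) ∈ Icc (0 : ℝ) 1 := right_mem_Icc.2 zero_le_one
  ext l
  constructor
  · rintro ⟨f, ⟨⟨x, hx, hfx⟩, g, hG, hg⟩, hf0, hf1⟩
    have h1 := (eq_sol_of_graph hG hg h1I).1
    have h2 := (eq_sol_of_graph hG hg hx).1
    have ha := sol_smul μ (derivWithin f (Icc 0 1) 0) 0 1 l hx
    have hb := sol_smul μ (derivWithin f (Icc 0 1) 0) 0 1 l h1I
    rw [mul_one, mul_zero] at ha hb
    rw [hf1, hf0, hb] at h1
    rw [hf0, ha] at h2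
    refine (mul_eq_zero.1 h1.symm).resolve_left fun h => hfx ?_
    rw [h2, h, zero_mul]
  · intro hl
    exact ⟨sol μ 0 1 l, isEigenfunction_sol hμ (Or.inr one_ne_zero) l, sol_zero μ 0 1 l, hl⟩

/-- With common initial data the Lagrange identity has no term at `0`, and at a zero of one boundary
value the factor `r` is, up to sign, the other boundary value at `1`. -/
theorem isCharacteristic_sol (hμ : μ (Icc (0 : ℝ) 1)ᶜ = 0) {a b : ℝ} (hab : a ≠ 0 ∨ b ≠ 0)
    (h0 : b * a = 0) : IsCharacteristic (fun l => sol μ a b l 1) (solInner μ a b) where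
  continuous := continuous_sol_param μ a b (right_mem_Icc.2 zero_le_one)
  continuous_kernel := continuous_solInner μ a b
  kernel_self_pos := solInner_self_pos hμ hab
  exists_mul_eq k hk := ⟨dsol μ a b k 1, fun l => by
    have h : _ = _ + (k - l) * solInner μ a b l k :=
      lagrange_identity μ a b l a b k (right_mem_Icc.2 zero_le_one)
    rw [hk] at h
    linarith⟩
  nonneg_of_eq_zero k hk := nonneg_of_boundary hμ hab h0 (by rw [hk, mul_zero])

theorem isCharacteristic_dsol (hμ : μ (Icc (0 : ℝ) 1)ᶜ = 0) {a b : ℝ} (hab : a ≠ 0 ∨ b ≠ 0)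
    (h0 : b * a = 0) : IsCharacteristic (fun l => dsol μ a b l 1) (solInner μ a b) where
  continuous := continuous_dsol_param μ a b (right_mem_Icc.2 zero_le_one)
  continuous_kernel := continuous_solInner μ a b
  kernel_self_pos := solInner_self_pos hμ hab
  exists_mul_eq k hk := ⟨-sol μ a b k 1, fun l => by
    have h : _ = _ + (k - l) * solInner μ a b l k :=
      lagrange_identity μ a b l a b k (right_mem_Icc.2 zero_le_one)
    rw [hk] at h
    linarith⟩
  nonneg_of_eq_zero k hk := nonneg_of_boundary hμ hab h0 (by rw [hk, zero_mul])

end Spectrum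

theorem exists_eq_zero_of_mul_nonpos {f : ℝ → ℝ} {x y : ℝ} (hxy : x ≤ y)
    (hf : ContinuousOn f (Icc x y)) (h : f x * f y ≤ 0) : ∃ z ∈ Icc x y, f z = 0 := by
  rw [← uIcc_of_le hxy] at hf ⊢
  have h0 : (0 : ℝ) ∈ uIcc (f x) (f y) := by
    rw [mem_uIcc]
    rcases mul_nonpos_iff.1 h with h | h
    · exact Or.inr ⟨h.2, h.1⟩
    · exact Or.inl ⟨h.1, h.2⟩
  exact intermediate_value_uIcc hf h0

/-! ### Many zeros for large parameters -/

section Oscillation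

variable (μ : Measure ℝ) [IsProbabilityMeasure μ] [NullSingletonClass μ]

theorem dsol_sub_dsol_eq (a b l : ℝ) {x y : ℝ} (hx : x ∈ Icc (0 : ℝ) 1) (hy : y ∈ Icc (0 : ℝ) 1) :
    dsol μ a b l x - dsol μ a b l y = l * ∫ t in x..y, sol μ a b l t ∂μ := by
  have hc := continuous_sol μ a b l
  rw [dsol_eq μ a b hx, dsol_eq μ a b hy,
    ← intervalIntegral.integral_interval_sub_left (hc.intervalIntegrable 0 y)
      (hc.intervalIntegrable 0 x)]
  ring

/-- For `l ≥ 0` a positive solution is concave. With room `δ` on both sides, concavity bounds the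
inner slopes by values over `δ` and makes `u p'` and `u q'` comparable to their minimum `m`. Since
`l * m * μ(p', q') ≤ l ∫ u dμ = u'(p') - u'(q')`, a positive mass bounds `l`. -/
theorem mul_mass_le_of_pos {p p' q' q δ : ℝ} (hp : 0 ≤ p) (hq : q ≤ 1) (hδ : 0 < δ)
    (hpp : p + δ ≤ p') (hpq : p' < q') (hqq : q' + δ ≤ q) {a b l : ℝ} (hl : 0 ≤ l)
    (hpos : ∀ x ∈ Ioo p q, 0 < sol μ a b l x) :
    l * (∫ _ in p'..q', (1 : ℝ) ∂μ) ≤ 2 * (1 + 1 / δ) / δ := by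
  set u := sol μ a b l with hu
  set d := dsol μ a b l with hd
  have hpq' : p < q := by linarith
  have huc : Continuous u := continuous_sol μ a b l
  have hder : ∀ x, HasDerivAt u (d x) x := hasDerivAt_sol μ a b l
  have hI : Icc p q ⊆ Icc 0 1 := Icc_subset_Icc hp hq
  have hnn : ∀ x ∈ Icc p q, 0 ≤ u x := by
    rw [← closure_Ioo hpq'.ne]
    exact fun x hx => closure_minimal (fun y hy => (hpos y hy).le)
      (isClosed_le continuous_const huc) hx
  have hanti : AntitoneOn d (Icc p q) := by
    intro x hx y hy hxy
    have h1 := dsol_sub_dsol_eq μ a b l (hI hx) (hI hy)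
    have h2 : 0 ≤ ∫ t in x..y, u t ∂μ := intervalIntegral.integral_nonneg hxy fun t ht =>
      hnn t ⟨hx.1.trans ht.1, ht.2.trans hy.2⟩
    have := mul_nonneg hl h2
    linarith
  have hconc : ConcaveOn ℝ (Icc p q) u := by
    refine AntitoneOn.concaveOn_of_deriv (convex_Icc p q) huc.continuousOn
      (fun x _ => (hder x).differentiableAt.differentiableWithinAt) ?_
    rw [funext fun x => (hder x).deriv]
    exact hanti.mono interior_subset
  have hpm : p ∈ Icc p q := ⟨le_rfl, hpq'.le⟩
  have hqm : q ∈ Icc p q := ⟨hpq'.le, le_rfl⟩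
  have hp'm : p' ∈ Icc p q := ⟨by linarith, by linarith⟩
  have hq'm : q' ∈ Icc p q := ⟨by linarith, by linarith⟩
  have hs : 0 < u p' := hpos p' ⟨by linarith, by linarith⟩
  have ht : 0 < u q' := hpos q' ⟨by linarith, by linarith⟩
  have hmin : 0 < min (u p') (u q') := lt_min hs ht
  set m := min (u p') (u q')
  -- one-sided slopes
  have hslope_left : (u p' - u p) / (p' - p) ≤ u p' / δ := by
    gcongr
    · linarith [hnn p hpm]
    · linarith
  have hslope_right : -((u q - u q') / (q - q')) ≤ u q' / δ := by
    rw [← neg_div, neg_sub]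
    gcongr
    · linarith [hnn q hqm]
    · linarith
  have h1 : (u q' - u p') / (q' - p') ≤ u p' / δ :=
    (hconc.slope_anti_adjacent hpm hq'm (by linarith) hpq).trans hslope_left
  have h2 : -((u q' - u p') / (q' - p')) ≤ u q' / δ :=
    (neg_le_neg (hconc.slope_anti_adjacent hp'm hqm hpq (by linarith))).trans hslope_right
  have hlen : q' - p' ≤ 1 := by linarith
  have hlen0 : 0 < q' - p' := by linarith
  have h3 : u q' ≤ (1 + 1 / δ) * u p' := by
    rw [div_le_iff₀ hlen0] at h1
    have : u p' / δ * (q' - p') ≤ u p' / δ * 1 := by gcongr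
    have e : (1 + 1 / δ) * u p' = u p' + u p' / δ := by ring
    linarith
  have h4 : u p' ≤ (1 + 1 / δ) * u q' := by
    rw [← neg_div, neg_sub, div_le_iff₀ hlen0] at h2
    have : u q' / δ * (q' - p') ≤ u q' / δ * 1 := by gcongr
    have e : (1 + 1 / δ) * u q' = u q' + u q' / δ := by ring
    linarith
  have hone : 1 ≤ 1 + 1 / δ := by
    have : 0 < 1 / δ := by positivity
    linarith
  have h5 : u p' ≤ (1 + 1 / δ) * m := by
    rcases min_choice (u p') (u q') with h | h
    · rw [show m = u p' from h]
      exact le_mul_of_one_le_left hs.le hone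
    · rwa [show m = u q' from h]
  have h6 : u q' ≤ (1 + 1 / δ) * m := by
    rcases min_choice (u p') (u q') with h | h
    · rwa [show m = u p' from h]
    · rw [show m = u q' from h]
      exact le_mul_of_one_le_left ht.le hone
  -- the derivative at the inner points
  have h7 : d p' ≤ u p' / δ := by
    obtain ⟨ξ, hξ, e⟩ := exists_hasDerivAt_eq_slope u d (by linarith : p < p') huc.continuousOn
      fun x _ => hder x
    have := hanti ⟨hξ.1.le, hξ.2.le.trans hp'm.2⟩ hp'm hξ.2.le
    linarith
  have h8 : -d q' ≤ u q' / δ := by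
    obtain ⟨ξ, hξ, e⟩ := exists_hasDerivAt_eq_slope u d (by linarith : q' < q) huc.continuousOn
      fun x _ => hder x
    have := hanti hq'm ⟨hq'm.1.trans hξ.1.le, hξ.2.le⟩ hξ.1.le
    linarith
  have h9 : m * ∫ _ in p'..q', (1 : ℝ) ∂μ ≤ ∫ t in p'..q', u t ∂μ := by
    rw [← intervalIntegral.integral_const_mul]
    refine intervalIntegral.integral_mono_on hpq.le (continuous_const.intervalIntegrable _ _)
      (huc.intervalIntegrable _ _) fun t ht => ?_
    rw [mul_one]
    exact hconc.min_le_of_mem_Icc hp'm hq'm ht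
  have h10 := dsol_sub_dsol_eq μ a b l (hI hp'm) (hI hq'm)
  have h11 : l * (m * ∫ _ in p'..q', (1 : ℝ) ∂μ) ≤ 2 * (1 + 1 / δ) / δ * m := by
    calc l * (m * ∫ _ in p'..q', (1 : ℝ) ∂μ) ≤ l * ∫ t in p'..q', u t ∂μ := by gcongr
      _ = d p' - d q' := h10.symm
      _ ≤ (u p' + u q') / δ := by rw [add_div]; linarith
      _ ≤ ((1 + 1 / δ) * m + (1 + 1 / δ) * m) / δ := by gcongr
      _ = _ := by ring
  refine le_of_mul_le_mul_right ?_ hmin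
  linarith

theorem eventually_exists_zero {p p' q' q : ℝ} (hp : 0 ≤ p) (hq : q ≤ 1)
    (hpp : p < p') (hpq : p' < q') (hqq : q' < q) (hmass : 0 < ∫ _ in p'..q', (1 : ℝ) ∂μ)
    (a b : ℝ) : ∀ᶠ l in atTop, ∃ x ∈ Ioo p q, sol μ a b l x = 0 := by
  set δ := min (p' - p) (q - q') with hδ_def
  have hδ : 0 < δ := lt_min (by linarith) (by linarith)
  have h1 : p + δ ≤ p' := by linarith [min_le_left (p' - p) (q - q')]
  have h2 : q' + δ ≤ q := by linarith [min_le_right (p' - p) (q - q')]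
  set w := ∫ _ in p'..q', (1 : ℝ) ∂μ
  filter_upwards [eventually_ge_atTop 0, eventually_gt_atTop (2 * (1 + 1 / δ) / δ / w)]
    with l hl hlarge
  rw [div_lt_iff₀ hmass] at hlarge
  by_contra! hne
  have hmid : (p + q) / 2 ∈ Ioo p q := ⟨by linarith, by linarith⟩
  have hsign : ∀ x ∈ Ioo p q, 0 < sol μ a b l ((p + q) / 2) * sol μ a b l x := by
    intro x hx
    by_contra! hle
    have hc := (continuous_sol μ a b l).continuousOn (s := Icc (min ((p + q) / 2) x) (max ((p + q) / 2) x))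
    obtain ⟨z, hz, hz0⟩ := exists_eq_zero_of_mul_nonpos min_le_max hc (by
      rcases le_total ((p + q) / 2) x with h | h
      · rwa [min_eq_left h, max_eq_right h]
      · rwa [min_eq_right h, max_eq_left h, mul_comm])
    exact hne z ⟨(lt_min hmid.1 hx.1).trans_le hz.1, hz.2.trans_lt (max_lt hmid.2 hx.2)⟩ hz0
  rcases lt_or_gt_of_ne (hne _ hmid) with hneg | hpos
  -- A negative solution is reflected by negating the initial data.
  · have := mul_mass_le_of_pos μ hp hq hδ h1 hpq h2 (a := -1 * a) (b := -1 * b) hl fun x hx => by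
      rw [sol_smul μ (-1) a b l ⟨hp.trans hx.1.le, hx.2.le.trans hq⟩]
      linarith [neg_of_mul_pos_right (hsign x hx) hneg.le]
    linarith
  · have := mul_mass_le_of_pos μ hp hq hδ h1 hpq h2 (a := a) (b := b) hl fun x hx =>
      (pos_iff_pos_of_mul_pos (hsign x hx)).1 hpos
    linarith

variable {μ}

theorem exists_many_zeros (hμ : IsNonatomicProb μ) (a b : ℝ) (k : ℕ) :
    ∃ l, 0 ≤ l ∧ ∃ t : Fin k → ℝ, Function.Injective t ∧
      ∀ i, t i ∈ Icc (0 : ℝ) 1 ∧ sol μ a b l (t i) = 0 := by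
  rcases Nat.eq_zero_or_pos k with rfl | hk
  · exact ⟨0, le_rfl, Fin.elim0, fun i => i.elim0, fun i => i.elim0⟩
  set F : ℝ → ℝ := fun x => ∫ _ in (0 : ℝ)..x, (1 : ℝ) ∂μ with hF
  have hFc : Continuous F := continuous_integral_measure μ continuous_const
  have hF0 : F 0 = 0 := by simp [hF]
  have hF1 : F 1 = 1 := by
    rw [hF]
    simp only
    rw [integral_one_eq_cdf hμ (right_mem_Icc.2 zero_le_one), cdf_eq_real]
    refine (measureReal_congr (t := univ) ?_).trans probReal_univ
    filter_upwards [mem_ae_iff.2 hμ.compl_Icc] with x hx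
    exact propext ⟨fun _ => trivial, fun _ => hx.2⟩
  have hFsub : ∀ x y, F y - F x = ∫ _ in x..y, (1 : ℝ) ∂μ := fun x y =>
    intervalIntegral.integral_interval_sub_left (continuous_const.intervalIntegrable _ _)
      (continuous_const.intervalIntegrable _ _)
  have hFmono : Monotone F := fun x y hxy => by
    have : 0 ≤ F y - F x := by
      rw [hFsub]
      exact intervalIntegral.integral_nonneg hxy fun _ _ => zero_le_one
    linarith
  have hk' : (0 : ℝ) < 3 * k := by positivity
  -- Quantiles of order `j / (3k)`, three cells per zero: the middle cell carries mass, the outer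
  -- two provide room for concavity.
  have hex : ∀ j : ℕ, ∃ x, j ≤ 3 * k → x ∈ Icc (0 : ℝ) 1 ∧ F x = j / (3 * k) := by
    intro j
    by_cases hj : j ≤ 3 * k
    · have hj' : (j : ℝ) ≤ 3 * k := by exact_mod_cast hj
      obtain ⟨x, hx, hxF⟩ := intermediate_value_Icc zero_le_one hFc.continuousOn
        (show (j : ℝ) / (3 * k) ∈ Icc (F 0) (F 1) by
          rw [hF0, hF1]
          exact ⟨by positivity, (div_le_one hk').2 hj'⟩)
      exact ⟨x, fun _ => ⟨hx, hxF⟩⟩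
    · exact ⟨0, fun h => absurd h hj⟩
  choose x hx using hex
  have hlt : ∀ i j : ℕ, i < j → j ≤ 3 * k → x i < x j := by
    intro i j hij hj
    by_contra! hle
    have h1 := hFmono hle
    rw [(hx i (by omega)).2, (hx j hj).2, div_le_div_iff_of_pos_right hk'] at h1
    exact absurd (Nat.cast_le.1 h1) (not_le.2 hij)
  have hzero : ∀ᶠ l in atTop, ∀ i : Fin k,
      ∃ y ∈ Ioo (x (3 * i)) (x (3 * i + 3)), sol μ a b l y = 0 := by
    refine eventually_all.2 fun i => ?_
    have hi := i.2
    refine eventually_exists_zero μ (hx _ (by omega)).1.1 (hx _ (by omega)).1.2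
      (hlt _ (3 * i + 1) (by omega) (by omega)) (hlt _ (3 * i + 2) (by omega) (by omega))
      (hlt _ _ (by omega) (by omega)) ?_ a b
    rw [← hFsub, (hx _ (by omega)).2, (hx _ (by omega)).2, ← sub_div]
    refine div_pos ?_ hk'
    push_cast
    linarith
  obtain ⟨l, hl0, hl⟩ := ((eventually_ge_atTop 0).and hzero).exists
  choose y hy hy0 using hl
  refine ⟨l, hl0, y, ?_, fun i => ⟨?_, hy0 i⟩⟩
  · refine StrictMono.injective fun i j hij => ?_
    have hij' : (i : ℕ) < j := hij
    have hj := j.2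
    have : x (3 * i + 3) ≤ x (3 * j) := by
      rcases Nat.lt_or_ge (3 * i + 3) (3 * j) with h | h
      · exact (hlt _ _ h (by omega)).le
      · rw [show 3 * (i : ℕ) + 3 = 3 * j by omega]
    exact (hy i).2.trans_le (this.trans (hy j).1.le)
  · have hi := i.2
    exact ⟨(hx (3 * i) (by omega)).1.1.trans (hy i).1.le,
      (hy i).2.le.trans (hx (3 * i + 3) (by omega)).1.2⟩

end Oscillation

/-! ### Zeros of solutions, and infinitely many eigenvalues -/

section Sturm

variable (μ : Measure ℝ) [IsProbabilityMeasure μ] [NullSingletonClass μ] {a b : ℝ}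

/-- By compactness `|u| + |u'| ≥ m > 0`. Between two zeros Rolle gives a point with `u' = 0`, hence
`|u| ≥ m` there, and the bound `D` on `u'` keeps it at a distance from the zeros. The denominator is
`D + 1` because `D` may be zero. -/
theorem exists_zero_separation (hab : a ≠ 0 ∨ b ≠ 0) {Λ : ℝ} (hΛ : 0 ≤ Λ) :
    ∃ δ > 0, ∀ l ∈ Icc 0 Λ, ∀ x ∈ Icc (0 : ℝ) 1, ∀ y ∈ Icc (0 : ℝ) 1, x ≠ y →
      sol μ a b l x = 0 → sol μ a b l y = 0 → δ ≤ |x - y| := by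
  have hc : ContinuousOn (fun p : ℝ × ℝ => |sol μ a b p.1 p.2| + |dsol μ a b p.1 p.2|)
      (Icc 0 Λ ×ˢ Icc 0 1) :=
    ((continuousOn_sol μ a b).abs.add (continuousOn_dsol μ a b).abs).mono
      (prod_mono (subset_univ _) Subset.rfl)
  obtain ⟨⟨l₀, x₀⟩, ⟨hl₀, hx₀⟩, hmin⟩ := (isCompact_Icc.prod isCompact_Icc).exists_isMinOn
    ⟨(0, 0), ⟨⟨le_rfl, hΛ⟩, ⟨le_rfl, zero_le_one⟩⟩⟩ hc
  set m := |sol μ a b l₀ x₀| + |dsol μ a b l₀ x₀| with hm_def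
  have hm : 0 < m := by
    rcases sol_ne_zero_or_dsol_ne_zero μ hab l₀ hx₀ with h | h <;> positivity
  have hD := dsolBound_nonneg a b hΛ
  set D := dsolBound a b Λ
  have key : ∀ l ∈ Icc 0 Λ, ∀ x ∈ Icc (0 : ℝ) 1, ∀ y ∈ Icc (0 : ℝ) 1, x < y →
      sol μ a b l x = 0 → sol μ a b l y = 0 → m / (D + 1) ≤ y - x := by
    intro l hl x hx y hy hxy h0x h0y
    obtain ⟨ξ, hξ, hξ0⟩ := exists_hasDerivAt_eq_zero hxy (continuous_sol μ a b l).continuousOn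
      (h0x.trans h0y.symm) fun z _ => hasDerivAt_sol μ a b l z
    have hξI : ξ ∈ Icc (0 : ℝ) 1 := ⟨hx.1.trans hξ.1.le, hξ.2.le.trans hy.2⟩
    have h1 : m ≤ |sol μ a b l ξ| + |dsol μ a b l ξ| := hmin (⟨hl, hξI⟩ : (l, ξ) ∈ Icc 0 Λ ×ˢ Icc 0 1)
    have hlΛ : |l| ≤ Λ := by rw [abs_of_nonneg hl.1]; exact hl.2
    have h2 := (convex_Icc (0 : ℝ) 1).norm_image_sub_le_of_norm_hasDerivWithin_le (C := D)
      (fun z _ => (hasDerivAt_sol μ a b l z).hasDerivWithinAt)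
      (fun z hz => abs_dsol_le μ a b hlΛ hz) hx hξI
    rw [h0x, sub_zero, Real.norm_eq_abs, Real.norm_eq_abs, abs_of_pos (sub_pos.2 hξ.1)] at h2
    rw [hξ0, abs_zero, add_zero] at h1
    rw [div_le_iff₀ (by positivity)]
    nlinarith [hξ.1, hξ.2]
  refine ⟨m / (D + 1), by positivity, fun l hl x hx y hy hxy h0x h0y => ?_⟩
  rcases hxy.lt_or_gt with h | h
  · rw [abs_sub_comm, abs_of_pos (sub_pos.2 h)]
    exact key l hl x hx y hy h h0x h0y
  · rw [abs_of_pos (sub_pos.2 h)]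
    exact key l hl y hy x hx h h0y h0x

theorem finite_zeros (hab : a ≠ 0 ∨ b ≠ 0) {l : ℝ} (hl : 0 ≤ l) :
    {x | x ∈ Icc (0 : ℝ) 1 ∧ sol μ a b l x = 0}.Finite := by
  obtain ⟨δ, hδ, hsep⟩ := exists_zero_separation μ hab hl
  by_contra hinf
  obtain ⟨x, -, hacc⟩ := Set.Infinite.exists_accPt_of_subset_isCompact hinf
    (isCompact_Icc (a := (0 : ℝ)) (b := 1)) fun y hy => hy.1
  have hclosed : IsClosed {x | x ∈ Icc (0 : ℝ) 1 ∧ sol μ a b l x = 0} :=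
    isClosed_Icc.inter (isClosed_eq (continuous_sol μ a b l) continuous_const)
  have hx : x ∈ {x | x ∈ Icc (0 : ℝ) 1 ∧ sol μ a b l x = 0} := by
    have := mem_closure_iff_clusterPt.2 hacc.clusterPt
    rwa [hclosed.closure_eq] at this
  rw [accPt_iff_nhds] at hacc
  obtain ⟨y, ⟨hyx, hy⟩, hne⟩ := hacc _ (Metric.ball_mem_nhds x hδ)
  have := hsep l ⟨hl, le_rfl⟩ y hy.1 x hx.1 hne hy.2 hx.2
  rw [Metric.mem_ball, Real.dist_eq] at hyx
  linarith

/-- A zero inside `(0,1)` is simple, so the sign change around it persists. A zero at `0` is there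
for every parameter. At `1` there is no room on the right, and the zero may leave the interval. -/
theorem eventually_exists_zero_near (hab : a ≠ 0 ∨ b ≠ 0) {l x η : ℝ} (hη : 0 < η)
    (hx : x ∈ Ico (0 : ℝ) 1) (hx0 : sol μ a b l x = 0) :
    ∀ᶠ l' in 𝓝 l, ∃ y ∈ Icc (0 : ℝ) 1, |y - x| < η ∧ sol μ a b l' y = 0 := by
  rcases hx.1.eq_or_lt with rfl | hpos
  · rw [sol_zero] at hx0
    exact Eventually.of_forall fun l' => ⟨0, ⟨le_rfl, zero_le_one⟩, by simpa using hη,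
      by rw [sol_zero, hx0]⟩
  have hxI : x ∈ Icc (0 : ℝ) 1 := ⟨hx.1, hx.2.le⟩
  have hd : dsol μ a b l x ≠ 0 :=
    (sol_ne_zero_or_dsol_ne_zero μ hab l hxI).resolve_left (not_not.2 hx0)
  set d := dsol μ a b l x
  have hslope : ∀ᶠ y in 𝓝[≠] x, 0 < d * slope (sol μ a b l) x y :=
    ((hasDerivAt_iff_tendsto_slope.1 (hasDerivAt_sol μ a b l x)).const_mul d).eventually_const_lt
      (mul_self_pos.2 hd)
  have hnear : ∀ᶠ y in 𝓝 x, y ∈ Ioo (max 0 (x - η)) (min 1 (x + η)) :=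
    Ioo_mem_nhds (max_lt hpos (by linarith)) (lt_min hx.2 (by linarith))
  have hval : ∀ y, y ≠ x → sol μ a b l y = (y - x) * slope (sol μ a b l) x y := fun y hy => by
    rw [slope_def_field, hx0, sub_zero, mul_div_cancel₀ _ (sub_ne_zero.2 hy)]
  obtain ⟨y₁, ⟨hs₁, hn₁⟩, hy₁⟩ := (((hslope.filter_mono (nhdsWithin_mono x fun y (hy : y ∈ Iio x) =>
    (mem_Iio.1 hy).ne)).and (hnear.filter_mono nhdsWithin_le_nhds)).and
      (self_mem_nhdsWithin (s := Iio x))).exists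
  obtain ⟨y₂, ⟨hs₂, hn₂⟩, hy₂⟩ := (((hslope.filter_mono (nhdsWithin_mono x fun y (hy : y ∈ Ioi x) =>
    (mem_Ioi.1 hy).ne')).and (hnear.filter_mono nhdsWithin_le_nhds)).and
      (self_mem_nhdsWithin (s := Ioi x))).exists
  have h1 : d * sol μ a b l y₁ < 0 := by
    rw [hval y₁ hy₁.ne, mul_left_comm]
    exact mul_neg_of_neg_of_pos (sub_neg.2 hy₁) hs₁
  have h2 : 0 < d * sol μ a b l y₂ := by
    rw [hval y₂ hy₂.ne', mul_left_comm]
    exact mul_pos (sub_pos.2 hy₂) hs₂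
  have hI : ∀ y ∈ Ioo (max 0 (x - η)) (min 1 (x + η)), y ∈ Icc (0 : ℝ) 1 := fun y hy =>
    ⟨(le_max_left _ _).trans hy.1.le, hy.2.le.trans (min_le_left _ _)⟩
  have hc1 := ((continuous_sol_param μ a b (hI y₁ hn₁)).const_mul d).continuousAt (x := l)
  have hc2 := ((continuous_sol_param μ a b (hI y₂ hn₂)).const_mul d).continuousAt (x := l)
  filter_upwards [hc1.eventually_lt_const h1, hc2.eventually_const_lt h2] with l' h1' h2'
  have hmul : sol μ a b l' y₁ * sol μ a b l' y₂ ≤ 0 := by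
    have h3 := mul_neg_of_neg_of_pos h1' h2'
    have h4 : 0 < d * d := mul_self_pos.2 hd
    have h5 : d * sol μ a b l' y₁ * (d * sol μ a b l' y₂) =
      d * d * (sol μ a b l' y₁ * sol μ a b l' y₂) := by ring
    rw [h5] at h3
    exact (neg_of_mul_neg_right h3 h4.le).le
  obtain ⟨y, hy, hy0⟩ := exists_eq_zero_of_mul_nonpos (hy₁.trans hy₂).le
    (continuous_sol μ a b l').continuousOn hmul
  have hyn : y ∈ Ioo (max 0 (x - η)) (min 1 (x + η)) :=
    ⟨hn₁.1.trans_le hy.1, hy.2.trans_lt hn₂.2⟩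
  refine ⟨y, hI y hyn, abs_lt.2 ⟨?_, ?_⟩, hy0⟩
  · linarith [(le_max_right 0 (x - η)).trans_lt hyn.1]
  · linarith [hyn.2.trans_le (min_le_right 1 (x + η))]

/-- The least parameter for which the solution has `k` zeros in `[0,1]` makes it vanish at `1`. -/
theorem exists_zero_at_one_of_many_zeros (hab : a ≠ 0 ∨ b ≠ 0) {k : ℕ} (hk : 2 ≤ k) {Λ : ℝ}
    (hΛ : 0 ≤ Λ) {t₀ : Fin k → ℝ} (ht₀ : Function.Injective t₀)
    (ht₀' : ∀ i, t₀ i ∈ Icc (0 : ℝ) 1 ∧ sol μ a b Λ (t₀ i) = 0) :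
    ∃ l, 0 ≤ l ∧ sol μ a b l 1 = 0 ∧ ∃ t : Fin k → ℝ, Function.Injective t ∧
      ∀ i, t i ∈ Icc (0 : ℝ) 1 ∧ sol μ a b l (t i) = 0 := by
  obtain ⟨δ, hδ, hsep⟩ := exists_zero_separation μ hab hΛ
  set X : Set (ℝ × (Fin k → ℝ)) := Icc 0 Λ ×ˢ Icc 0 1 with hX
  have hXI : ∀ p ∈ X, ∀ i, p.2 i ∈ Icc (0 : ℝ) 1 := fun p hp i => ⟨hp.2.1 i, hp.2.2 i⟩
  -- Parameters with `k` zeros. Separation by `δ` replaces distinctness as a closed condition, which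
  -- makes `K` compact, so that a least parameter exists.
  set K : Set (ℝ × (Fin k → ℝ)) := (⋂ i, X ∩ (fun p => sol μ a b p.1 (p.2 i)) ⁻¹' {0}) ∩
    ⋂ i, ⋂ j, {p | i ≠ j → δ ≤ |p.2 i - p.2 j|} with hK
  have hk0 : Nonempty (Fin k) := ⟨⟨0, by omega⟩⟩
  have hKmem : ∀ p, p ∈ K ↔ p ∈ X ∧ (∀ i, sol μ a b p.1 (p.2 i) = 0) ∧
      ∀ i j, i ≠ j → δ ≤ |p.2 i - p.2 j| := by
    intro p
    simp only [hK, mem_inter_iff, mem_iInter, mem_preimage, mem_singleton_iff, mem_ofPred_eq]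
    exact ⟨fun h => ⟨(h.1 hk0.some).1, fun i => (h.1 i).2, h.2⟩,
      fun h => ⟨fun i => ⟨h.1, h.2.1 i⟩, h.2.2⟩⟩
  have hXc : IsCompact X := isCompact_Icc.prod isCompact_Icc
  have hKclosed : IsClosed K := by
    refine (isClosed_iInter fun i => ?_).inter
      (isClosed_iInter fun i => isClosed_iInter fun j => ?_)
    · refine ContinuousOn.preimage_isClosed_of_isClosed ?_ hXc.isClosed isClosed_singleton
      exact (continuousOn_sol μ a b).comp
        (f := fun p : ℝ × (Fin k → ℝ) => (p.1, p.2 i)) (by fun_prop)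
        fun p hp => ⟨mem_univ _, hXI p hp i⟩
    · by_cases hij : i = j
      · simp [hij]
      · simp only [ne_eq, hij, not_false_eq_true, true_imp_iff]
        exact isClosed_le continuous_const (by fun_prop)
  have hKc : IsCompact K := hXc.of_isClosed_subset hKclosed fun p hp => ((hKmem p).1 hp).1
  have hKne : K.Nonempty := ⟨(Λ, t₀), (hKmem _).2 ⟨⟨⟨hΛ, le_rfl⟩,
    ⟨fun i => (ht₀' i).1.1, fun i => (ht₀' i).1.2⟩⟩, fun i => (ht₀' i).2, fun i j hij =>
      hsep Λ ⟨hΛ, le_rfl⟩ _ (ht₀' i).1 _ (ht₀' j).1 (ht₀.ne hij) (ht₀' i).2 (ht₀' j).2⟩⟩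
  obtain ⟨⟨l, t⟩, hmem, hmin⟩ := hKc.exists_isMinOn hKne continuous_fst.continuousOn
  obtain ⟨hltX, hzero, htsep⟩ := (hKmem _).1 hmem
  have hl : l ∈ Icc 0 Λ := hltX.1
  have htI : ∀ i, t i ∈ Icc (0 : ℝ) 1 := hXI _ hltX
  refine ⟨l, hl.1, ?_, t, fun i j hij => ?_, fun i => ⟨htI i, hzero i⟩⟩
  swap
  · by_contra hne
    have := htsep i j hne
    simp only at this
    rw [hij, sub_self, abs_zero] at this
    linarith
  by_contra hne1
  -- For `l = 0` the solution is affine and nonzero, so it cannot have two zeros; this is where `k ≥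
  -- 2` enters.
  have hl0 : 0 < l := by
    refine lt_of_le_of_ne hl.1 fun h0 => ?_
    have haff : ∀ x, sol μ a b l x = a + b * x := fun x => by rw [← h0, sol]; simp
    have hsp := htsep ⟨0, by omega⟩ ⟨1, by omega⟩ (by simp)
    have h1 := hzero ⟨0, by omega⟩
    have h2 := hzero ⟨1, by omega⟩
    simp only [haff] at h1 h2 hsp
    have hbt : b * (t ⟨0, by omega⟩ - t ⟨1, by omega⟩) = 0 := by linarith
    rcases mul_eq_zero.1 hbt with hb | ht
    · rw [hb, zero_mul, add_zero] at h1
      exact hab.elim (fun h => h h1) fun h => h hb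
    · rw [ht, abs_zero] at hsp
      linarith
  -- If `u(1) ≠ 0`, all `k` zeros lie in `[0,1)` and persist for slightly smaller parameters,
  -- against minimality.
  have hnear : ∀ᶠ l' in 𝓝 l, ∀ i, ∃ y ∈ Icc (0 : ℝ) 1, |y - t i| < δ / 2 ∧ sol μ a b l' y = 0 := by
    refine eventually_all.2 fun i => eventually_exists_zero_near μ hab (half_pos hδ)
      ⟨(htI i).1, lt_of_le_of_ne (htI i).2 fun h => hne1 ?_⟩ (hzero i)
    rw [← h]
    exact hzero i
  obtain ⟨l', ⟨hy, hl'0⟩, hl'⟩ := (((hnear.and (eventually_gt_nhds hl0)).filter_mono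
    nhdsWithin_le_nhds).and (self_mem_nhdsWithin (s := Iio l))).exists
  choose y hyI hyt hy0 using hy
  have hl'Λ : l' ∈ Icc 0 Λ := ⟨hl'0.le, hl'.le.trans hl.2⟩
  have hin : (l', y) ∈ K := by
    refine (hKmem _).2 ⟨⟨hl'Λ, ⟨fun i => (hyI i).1, fun i => (hyI i).2⟩⟩, hy0, fun i j hij => ?_⟩
    refine hsep l' hl'Λ _ (hyI i) _ (hyI j) (fun he => ?_) (hy0 i) (hy0 j)
    have h1 := htsep i j hij
    have h2 := hyt i
    have h3 := hyt j
    simp only at he h1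
    rw [he] at h2
    rw [abs_lt] at h2 h3
    have h4 : |t i - t j| < δ := abs_lt.2 ⟨by linarith, by linarith⟩
    linarith
  have : l ≤ l' := hmin hin
  linarith

variable {μ}

/-- Were there finitely many such parameters, the numbers of zeros of their solutions would be
bounded by some `M`. Yet one of these parameters admits `M + 2` zeros. -/
theorem infinite_zeros_sol (hμ : IsNonatomicProb μ) (hab : a ≠ 0 ∨ b ≠ 0) :
    {l | sol μ a b l 1 = 0}.Infinite := by
  intro hfin
  obtain ⟨M, hM⟩ : ∃ M : ℕ, ∀ l ∈ {l | sol μ a b l 1 = 0},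
      {x | x ∈ Icc (0 : ℝ) 1 ∧ sol μ a b l x = 0}.ncard ≤ M := by
    obtain ⟨M, hM⟩ := (hfin.image fun l =>
      {x | x ∈ Icc (0 : ℝ) 1 ∧ sol μ a b l x = 0}.ncard).bddAbove
    exact ⟨M, fun l hl => hM ⟨l, hl, rfl⟩⟩
  obtain ⟨Λ, hΛ, t₀, ht₀, ht₀'⟩ := exists_many_zeros hμ a b (M + 2)
  obtain ⟨l, hl, hl1, t, ht, ht'⟩ :=
    exists_zero_at_one_of_many_zeros μ hab (by omega) hΛ ht₀ ht₀'
  have h1 : (range t).ncard ≤ {x | x ∈ Icc (0 : ℝ) 1 ∧ sol μ a b l x = 0}.ncard :=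
    ncard_le_ncard (by rintro _ ⟨i, rfl⟩; exact ht' i) (finite_zeros μ hab hl)
  rw [← image_univ, ncard_image_of_injective _ ht, ncard_univ, Nat.card_fin] at h1
  have := hM l hl1
  omega

end Sturm

/-- Interlacing: `r k * B` increases through each zero `k`, while `B` has constant sign between the
consecutive zeros `α` and `γ`, so `r α` and `r γ` do not have the same strict sign. -/
theorem IsCharacteristic.exists_zero_between {B : ℝ → ℝ} {I : ℝ → ℝ → ℝ} (h : IsCharacteristic B I)
    {r : ℝ → ℝ} (hrc : Continuous r) (hr : ∀ k, B k = 0 → ∀ l, r k * B l = (l - k) * I l k)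
    {α β : ℝ} (hαβ : α < β) (hα : B α = 0) (hβ : B β = 0) : ∃ x ∈ Icc α β, r x = 0 := by
  obtain ⟨γ, ⟨hγ, hαγ, hγβ⟩, hmin⟩ := exists_min_image ({l | B l = 0} ∩ Ioc α β) id
    ((h.finite_zeros_inter_Iic β).subset fun x hx => ⟨hx.1, hx.2.2⟩) ⟨β, hβ, hαβ, le_rfl⟩
  obtain ⟨c₁, hc₁, ρ₁, hρ₁, h1⟩ := h.exists_kernel_lower_bound α
  obtain ⟨c₂, hc₂, ρ₂, hρ₂, h2⟩ := h.exists_kernel_lower_bound γ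
  obtain ⟨ρ, hρ, hρ1, hρ2, hρ3⟩ : ∃ ρ > 0, ρ ≤ ρ₁ ∧ ρ ≤ ρ₂ ∧ α + ρ < γ - ρ := by
    refine ⟨min (min ρ₁ ρ₂) ((γ - α) / 3), ?_, ?_, ?_, ?_⟩
    · have : 0 < γ - α := by linarith
      positivity
    · exact (min_le_left _ _).trans (min_le_left _ _)
    · exact (min_le_left _ _).trans (min_le_right _ _)
    · linarith [min_le_right (min ρ₁ ρ₂) ((γ - α) / 3)]
  have hright : 0 < r α * B (α + ρ) := by
    rw [hr α hα, add_sub_cancel_left]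
    exact mul_pos hρ (hc₁.trans_le (h1 _ ⟨by linarith, by linarith⟩ α ⟨by linarith, by linarith⟩))
  have hleft : r γ * B (γ - ρ) < 0 := by
    rw [hr γ hγ, sub_sub_cancel_left]
    exact mul_neg_of_neg_of_pos (neg_neg_of_pos hρ)
      (hc₂.trans_le (h2 _ ⟨by linarith, by linarith⟩ γ ⟨by linarith, by linarith⟩))
  have hsame : 0 < B (α + ρ) * B (γ - ρ) := by
    by_contra! hle
    obtain ⟨z, hz, hz0⟩ := exists_eq_zero_of_mul_nonpos hρ3.le h.continuous.continuousOn hle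
    have : γ ≤ z := hmin z ⟨hz0, by linarith [hz.1], by linarith [hz.2]⟩
    linarith [hz.2]
  have hmul : r α * r γ ≤ 0 := by
    have h3 := mul_neg_of_pos_of_neg hright hleft
    have h4 : r α * B (α + ρ) * (r γ * B (γ - ρ)) = B (α + ρ) * B (γ - ρ) * (r α * r γ) := by ring
    rw [h4] at h3
    exact (neg_of_mul_neg_right h3 hsame.le).le
  obtain ⟨x, hx, hx0⟩ := exists_eq_zero_of_mul_nonpos hαγ.le hrc.continuousOn hmul
  exact ⟨x, ⟨hx.1, hx.2.trans hγβ⟩, hx0⟩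

/-- For `B l = u(1)` the factor `r` is `u'(1)`, so infinitely many zeros of the former force
infinitely many of the latter. -/
theorem infinite_zeros_dsol {μ : Measure ℝ} [IsProbabilityMeasure μ] [NullSingletonClass μ]
    {a b : ℝ} (hμ : IsNonatomicProb μ) (hab : a ≠ 0 ∨ b ≠ 0) (h0 : b * a = 0) :
    {l | dsol μ a b l 1 = 0}.Infinite := by
  intro hfin
  have h1I : (1 : ℝ) ∈ Icc (0 : ℝ) 1 := right_mem_Icc.2 zero_le_one
  have hch := isCharacteristic_sol hμ.compl_Icc hab h0
  have hinf := infinite_zeros_sol hμ hab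
  obtain ⟨R, hR⟩ := hfin.bddAbove
  obtain ⟨α, hα, hαR⟩ := (hinf.sdiff (hch.finite_zeros_inter_Iic R)).nonempty
  obtain ⟨β, hβ, hβα⟩ := (hinf.sdiff (hch.finite_zeros_inter_Iic α)).nonempty
  have h1 : R < α := not_le.1 fun h => hαR ⟨hα, h⟩
  have h2 : α < β := not_le.1 fun h => hβα ⟨hβ, h⟩
  obtain ⟨x, hx, hx0⟩ := hch.exists_zero_between (continuous_dsol_param μ a b h1I) (fun k hk l => by
    have h : _ = _ + (k - l) * solInner μ a b l k := lagrange_identity μ a b l a b k h1I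
    rw [hk] at h
    linarith) h2 hα hβ
  have : x ≤ R := hR hx0
  linarith [hx.1]

/-! ### Assembly along a filter of measures -/

/-- The non-atomic Borel probability measures on `[0,1]`. -/
abbrev NonatomicProb : Type := {ν : Measure ℝ // IsNonatomicProb ν}

instance (ν : NonatomicProb) : IsProbabilityMeasure ν.1 := ν.2.isProbabilityMeasure

instance (ν : NonatomicProb) : NullSingletonClass ν.1 := ν.2.nullSingleton

/-- The filter of neighbourhoods of `μ` for the uniform distance of distribution functions. -/
noncomputable def nhdsCdf (μ : NonatomicProb) : Filter NonatomicProb :=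
  comap (fun ν : NonatomicProb => cdfDist μ.1 ν.1) (𝓝 0)

/-- Estimates along `nhdsCdf μ` fix the constant before any sequence is chosen; this transfers them
to sequences. -/
theorem tendsto_nhdsCdf {μ : NonatomicProb} {ν : ℕ → NonatomicProb}
    (h : TendstoUniformlyOn (fun n x => cdf (ν n).1 x) (fun x => cdf μ.1 x) atTop
      (Icc (0 : ℝ) 1)) : Tendsto ν atTop (nhdsCdf μ) :=
  tendsto_comap_iff.2 (tendsto_cdfDist h)

theorem exists_abs_nthLeast_zeros_sub_le (μ : NonatomicProb) {a b : ℝ}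
    {B : NonatomicProb → ℝ → ℝ}
    (hch : ∀ ν, IsCharacteristic (B ν) (solInner ν.1 a b))
    (hB : ∀ R, ∃ K, ∀ ν l, |l| ≤ R → |B ν l - B μ l| ≤ K * cdfDist μ.1 ν.1)
    (hinf : {l | B μ l = 0}.Infinite) (m : ℕ) :
    ∃ c > 0, ∀ᶠ ν in nhdsCdf μ,
      |nthLeast {l | B μ l = 0} m - nthLeast {l | B ν l = 0} m| ≤ c * cdfDist μ.1 ν.1 :=
  exists_abs_nthLeast_sub_le (hch μ) (Eventually.of_forall hch)
    (fun ν => cdfDist_nonneg μ.1 ν.1) tendsto_comap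
    (fun R => (hB R).imp fun _ hK => Eventually.of_forall hK)
    (fun _ => ⟨_, Eventually.of_forall fun ν _ _ hl hk =>
      abs_solInner_sub_solInner_le μ.1 ν.1 a b
        (abs_integral_one_sub_le_cdfDist μ.2 ν.2) hl hk⟩) hinf m

theorem exists_eventually_neumannEigenvalue_sub_le (μ : NonatomicProb) (m : ℕ) :
    ∃ c > 0, ∀ᶠ ν in nhdsCdf μ,
      |neumannEigenvalue μ.1 m - neumannEigenvalue ν.1 m| ≤ c * cdfDist μ.1 ν.1 := by
  have h1I : (1 : ℝ) ∈ Icc (0 : ℝ) 1 := right_mem_Icc.2 zero_le_one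
  simp only [neumannEigenvalue, neumannSpectrum_eq μ.2.compl_Icc,
    fun ν : NonatomicProb => neumannSpectrum_eq ν.2.compl_Icc]
  exact exists_abs_nthLeast_zeros_sub_le μ
    (fun ν => isCharacteristic_dsol ν.2.compl_Icc (Or.inl one_ne_zero) (by simp))
    (fun R => ⟨_, fun ν l hl => abs_dsol_sub_dsol_measure_le μ.1 ν.1 1 0
      (abs_integral_one_sub_le_cdfDist μ.2 ν.2) hl h1I⟩)
    (infinite_zeros_dsol μ.2 (Or.inl one_ne_zero) (by simp)) m

theorem exists_eventually_dirichletEigenvalue_sub_le (μ : NonatomicProb) (m : ℕ) :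
    ∃ c > 0, ∀ᶠ ν in nhdsCdf μ,
      |dirichletEigenvalue μ.1 m - dirichletEigenvalue ν.1 m| ≤ c * cdfDist μ.1 ν.1 := by
  have h1I : (1 : ℝ) ∈ Icc (0 : ℝ) 1 := right_mem_Icc.2 zero_le_one
  simp only [dirichletEigenvalue, dirichletSpectrum_eq μ.2.compl_Icc,
    fun ν : NonatomicProb => dirichletSpectrum_eq ν.2.compl_Icc]
  exact exists_abs_nthLeast_zeros_sub_le μ
    (fun ν => isCharacteristic_sol ν.2.compl_Icc (Or.inr one_ne_zero) (by simp))
    (fun R => ⟨_, fun ν l hl => abs_sol_sub_sol_measure_le μ.1 ν.1 0 1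
      (abs_integral_one_sub_le_cdfDist μ.2 ν.2) hl h1I⟩)
    (infinite_zeros_sol μ.2 (Or.inr one_ne_zero)) (m - 1)

theorem strictMono_neumannEigenvalue (μ : NonatomicProb) :
    StrictMono (neumannEigenvalue μ.1) ∧ range (neumannEigenvalue μ.1) = neumannSpectrum μ.1 := by
  have hfin := (isCharacteristic_dsol μ.2.compl_Icc (a := 1) (b := 0) (Or.inl one_ne_zero)
    (by simp)).finite_zeros_inter_Iic
  have hinf := infinite_zeros_dsol μ.2 (a := 1) (b := 0) (Or.inl one_ne_zero) (by simp)
  rw [← neumannSpectrum_eq μ.2.compl_Icc] at hfin hinf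
  exact ⟨strictMono_nthLeast hfin hinf, range_nthLeast hfin hinf⟩

theorem strictMonoOn_dirichletEigenvalue (μ : NonatomicProb) :
    StrictMonoOn (dirichletEigenvalue μ.1) (Ici 1) ∧
      dirichletEigenvalue μ.1 '' Ici 1 = dirichletSpectrum μ.1 := by
  have hfin := (isCharacteristic_sol μ.2.compl_Icc (a := 0) (b := 1) (Or.inr one_ne_zero)
    (by simp)).finite_zeros_inter_Iic
  have hinf := infinite_zeros_sol μ.2 (a := 0) (b := 1) (Or.inr one_ne_zero)
  rw [← dirichletSpectrum_eq μ.2.compl_Icc] at hfin hinf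
  refine ⟨fun i hi j _ hij => strictMono_nthLeast hfin hinf ?_, ?_⟩
  -- The index `m - 1` is truncated, so strictness needs `1 ≤ i`: the indices `0` and `1` give the
  -- same value.
  · rw [mem_Ici] at hi
    omega
  · rw [← range_nthLeast hfin hinf]
    ext x
    constructor
    · rintro ⟨m, -, rfl⟩
      exact ⟨m - 1, rfl⟩
    · rintro ⟨m, rfl⟩
      exact ⟨m + 1, Nat.le_add_left 1 m, rfl⟩

end KreinFeller

open KreinFeller in
theorem theorem3p7 (μ : Measure ℝ) (hμ : IsNonatomicProb μ) :
    -- the eigenvalues form strictly increasing sequences, which the indexing enumerates completely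
    (StrictMono (neumannEigenvalue μ) ∧
      range (neumannEigenvalue μ) = neumannSpectrum μ) ∧
    (StrictMonoOn (dirichletEigenvalue μ) (Ici 1) ∧
      dirichletEigenvalue μ '' Ici 1 = dirichletSpectrum μ) ∧
    -- Neumann eigenvalues
    (∀ m : ℕ, ∃ c : ℝ, 0 < c ∧
      ∀ ν : ℕ → Measure ℝ, (∀ n, IsNonatomicProb (ν n)) →
        TendstoUniformlyOn (fun n x => cdf (ν n) x) (fun x => cdf μ x) atTop (Icc (0 : ℝ) 1) →
        ∃ n₀ : ℕ, ∀ n ≥ n₀,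
          |neumannEigenvalue μ m - neumannEigenvalue (ν n) m| ≤ c * cdfDist μ (ν n)) ∧
    -- Dirichlet eigenvalues
    (∀ m : ℕ, 1 ≤ m → ∃ c : ℝ, 0 < c ∧
      ∀ ν : ℕ → Measure ℝ, (∀ n, IsNonatomicProb (ν n)) →
        TendstoUniformlyOn (fun n x => cdf (ν n) x) (fun x => cdf μ x) atTop (Icc (0 : ℝ) 1) →
        ∃ n₀ : ℕ, ∀ n ≥ n₀,
          |dirichletEigenvalue μ m - dirichletEigenvalue (ν n) m| ≤ c * cdfDist μ (ν n)) := by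
  let M : NonatomicProb := ⟨μ, hμ⟩
  refine ⟨strictMono_neumannEigenvalue M, strictMonoOn_dirichletEigenvalue M, fun m => ?_,
    fun m _ => ?_⟩
  · obtain ⟨c, hc, h⟩ := exists_eventually_neumannEigenvalue_sub_le M m
    exact ⟨c, hc, fun ν hν hlim => eventually_atTop.1
      ((tendsto_nhdsCdf (μ := M) (ν := fun n => ⟨ν n, hν n⟩) hlim).eventually h)⟩
  · obtain ⟨c, hc, h⟩ := exists_eventually_dirichletEigenvalue_sub_le M m
    exact ⟨c, hc, fun ν hν hlim => eventually_atTop.1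
      ((tendsto_nhdsCdf (μ := M) (ν := fun n => ⟨ν n, hν n⟩) hlim).eventually h)⟩
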